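/- Let $\log$ denote the base-$2$ logarithm. For a finite simple graph $G$ with vertex set $V$, $n = |V|$, let $\mathrm{STAB}(G) \subseteq \mathbb{R}^V$ be the convex hull of the characteristic vectors of the stable (independent) sets of $G$, and let $$H(G) = \min_{x \in \mathrm{STAB}(G),\ x > 0} \; -\frac{1}{n}\sum_{v \in V} \log x_v$$ be the (Körner) entropy of $G$. For a finite poset $P$, let $\overline{G}(P)$ be its incomparability graph (the vertices are the elements of $P$, and two of them are adjacent if and only if they are incomparable), let $e(P)$ be the number of linear extensions of $P$, and let $\kappa_2(P)$ be the number of connected components of $\overline{G}(P)$ that have exactly two vertices. Let $P$ be a finite poset of width $2$, that is, the largest antichains of $P$ have exactly two elements. Then $$|P| \cdot H(\overline{G}(P)) \le (2-\varepsilon)\,\log e(P) + \varepsilon\,\kappa_2(P),$$ where $\varepsilon = 2 - \dfrac{3\log 3 - 2}{\log 3} \approx 0.26$ (rounded to two decimals). -/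

import Mathlib

noncomputable section

namespace PosetEntropy

/-- The stable set polytope of `G`: the convex hull in `ℝ^V` of the characteristic vectors of the
stable (independent) sets of `G`. -/
def stab {V : Type*} (G : SimpleGraph V) : Set (V → ℝ) :=
  convexHull ℝ {x : V → ℝ | ∃ S : Set V, G.IsIndepSet S ∧ x = S.indicator 1}

/-- The function minimized in the definition of graph entropy:
`f(x) = - ∑ v, (1 / n) * log x_v` with `n = |V|` and base-2 logarithm. -/
def entropyObjective {V : Type*} [Fintype V] (x : V → ℝ) : ℝ :=
  -∑ v, (1 / (Fintype.card V : ℝ)) * Real.logb 2 (x v)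

/-- The (Körner) entropy of a finite graph with the uniform distribution on its vertices: the
minimum of `entropyObjective` over the points of the stable set polytope with positive coordinates.
That the infimum is a minimum is `graphEntropy_isLeast`. -/
def graphEntropy {V : Type*} [Fintype V] (G : SimpleGraph V) : ℝ :=
  sInf (entropyObjective '' {x : V → ℝ | x ∈ stab G ∧ ∀ v, 0 < x v})

theorem isCompact_stab {V : Type*} [Fintype V] (G : SimpleGraph V) : IsCompact (stab G) := by
  have h : {x : V → ℝ | ∃ S : Set V, G.IsIndepSet S ∧ x = S.indicator 1}.Finite := by
    refine (Set.finite_range (fun S : Set V => (S.indicator 1 : V → ℝ))).subset ?_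
    rintro x ⟨S, -, rfl⟩
    exact ⟨S, rfl⟩
  exact h.isCompact_convexHull ℝ

theorem exists_pos_mem_stab {V : Type*} [Fintype V] (G : SimpleGraph V) :
    ∃ x ∈ stab G, ∀ v, 0 < x v := by
  classical
  rcases isEmpty_or_nonempty V with hV | hV
  · exact ⟨(∅ : Set V).indicator 1, subset_convexHull ℝ _ ⟨∅, by simp [SimpleGraph.IsIndepSet], rfl⟩,
      fun v => (IsEmpty.false v).elim⟩
  · have hn : (0 : ℝ) < Fintype.card V := by exact_mod_cast Fintype.card_pos
    refine ⟨∑ v : V, ((Fintype.card V : ℝ)⁻¹) • (({v} : Set V).indicator 1 : V → ℝ), ?_, ?_⟩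
    · refine (convex_convexHull ℝ _).sum_mem (fun _ _ => by positivity) ?_ ?_
      · simp [hn.ne']
      · intro v _
        exact subset_convexHull ℝ _ ⟨{v}, by simp [SimpleGraph.IsIndepSet], rfl⟩
    · intro w
      have : (∑ v : V, ((Fintype.card V : ℝ)⁻¹) • (({v} : Set V).indicator 1 : V → ℝ)) w
          = (Fintype.card V : ℝ)⁻¹ := by
        simp [Finset.sum_apply, Pi.single_apply]
      rw [this]
      positivity

theorem nonneg_of_mem_stab {V : Type*} (G : SimpleGraph V) {x : V → ℝ} (hx : x ∈ stab G) (v : V) :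
    0 ≤ x v := by
  have h : stab G ⊆ {x : V → ℝ | 0 ≤ x} := by
    refine convexHull_min ?_ (convex_Ici (0 : V → ℝ))
    rintro x ⟨S, -, rfl⟩
    exact fun v => Set.indicator_nonneg (fun _ _ => zero_le_one) v
  exact h hx v

/-- The minimum in the definition of graph entropy is attained. -/
theorem graphEntropy_isLeast {V : Type*} [Fintype V] (G : SimpleGraph V) :
    IsLeast (entropyObjective '' {x : V → ℝ | x ∈ stab G ∧ ∀ v, 0 < x v}) (graphEntropy G) := by
  obtain ⟨y, hy, hypos⟩ := exists_pos_mem_stab G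
  obtain ⟨x, hx, hmax⟩ := (isCompact_stab G).exists_isMaxOn ⟨y, hy⟩
    (f := fun x : V → ℝ => ∏ v, x v) (by fun_prop)
  have hprod : 0 < ∏ v, x v := lt_of_lt_of_le (Finset.prod_pos fun v _ => hypos v) (hmax hy)
  have hxpos : ∀ v, 0 < x v := fun v =>
    lt_of_le_of_ne (nonneg_of_mem_stab G hx v) fun h0 =>
      hprod.ne' (Finset.prod_eq_zero (Finset.mem_univ v) h0.symm)
  have hobj : ∀ z : V → ℝ, (∀ v, 0 < z v) →
      entropyObjective z = -((1 / (Fintype.card V : ℝ)) * Real.logb 2 (∏ v, z v)) := by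
    intro z hz
    rw [entropyObjective, ← Finset.mul_sum, Real.logb_prod]
    exact fun v _ => (hz v).ne'
  have hle : IsLeast (entropyObjective '' {x : V → ℝ | x ∈ stab G ∧ ∀ v, 0 < x v})
      (entropyObjective x) := by
    refine ⟨⟨x, ⟨hx, hxpos⟩, rfl⟩, ?_⟩
    rintro _ ⟨z, ⟨hz, hzpos⟩, rfl⟩
    rw [hobj x hxpos, hobj z hzpos]
    have h1 : Real.logb 2 (∏ v, z v) ≤ Real.logb 2 (∏ v, x v) :=
      Real.logb_le_logb_of_le (by norm_num) (Finset.prod_pos fun v _ => hzpos v) (hmax hz)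
    exact neg_le_neg (mul_le_mul_of_nonneg_left h1 (by positivity))
  have heq : graphEntropy G = entropyObjective x := hle.csInf_eq
  rw [heq]
  exact hle

/-- The incomparability graph of a poset: distinct elements are adjacent when neither is below the
other. -/
def incompGraph (P : Type*) [PartialOrder P] : SimpleGraph P where
  Adj a b := IncompRel (· ≤ ·) a b
  symm := ⟨fun _ _ h => h.symm⟩
  loopless := ⟨fun _ h => h.1 le_rfl⟩

/-- The number `e(P)` of linear extensions of `P`, i.e. of linear orders on the ground set of `P`
that contain the order of `P`. -/
def numLinearExtensions (P : Type*) [PartialOrder P] : ℕ :=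
  Nat.card {r : P → P → Prop // IsLinearOrder P r ∧ ∀ a b, a ≤ b → r a b}

/-- The poset `P` has width `k`: the largest antichains of `P` have exactly `k` elements. -/
def HasWidth (P : Type*) [PartialOrder P] (k : ℕ) : Prop :=
  IsGreatest {m : ℕ | ∃ A : Finset P, IsAntichain (· ≤ ·) (A : Set P) ∧ A.card = m} k

/-- The number `κ₂(P)` of connected components with exactly two vertices of the incomparability
graph of `P`. -/
def kappaTwo (P : Type*) [PartialOrder P] : ℕ :=
  Nat.card {C : (incompGraph P).ConnectedComponent // C.supp.ncard = 2}

/-- The constant `ε = 2 - (3 log 3 - 2) / log 3`, with base-2 logarithms. -/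
def eps : ℝ :=
  2 - (3 * Real.logb 2 3 - 2) / Real.logb 2 3

end PosetEntropy

end

/-
Both sides are additive over the components of the incomparability graph, up to an inequality in
the right direction, so let the graph be connected. It is bipartite by Dilworth's theorem, hence the
stable set polytope is cut out by the edge inequalities `x u + x v ≤ 1`. Give each element of the
two chains an interval of length `1 / x v` at an optimal point `x`, placed consecutively along the
chain. First-order optimality shows that the two chains cover the same segment and that overlapping
intervals belong to incomparable elements with a tight edge inequality, which leaves only stars and
alternating stretches as local patterns.

The entropy is bounded by the cost of the rounded point `rounding (x v)`. Its exponential is a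
product of weights, and a sweep along the segment compares the weights of the elements passed so far
with the number of linear extensions of the part of the poset that they form. The rounding makes the
weights depend only on the integer part of `1 / x`. The comparison is lost only if the component
consists of two elements, whose cost is `2` while it has just two linear extensions; this accounts
for `κ₂`. The value of `ε` is the one for which a star with two leaves (three linear extensions,
cost `3 log 3 - 2`) attains equality.
-/

open Finset

noncomputable section

namespace PosetEntropy

section Dilworth

variable {P : Type*} [PartialOrder P] [Finite P] {k : ℕ}

/- Hall's condition holds because the elements of `X` that lie above no element of `X` form an
antichain. -/
theorem exists_injective_lt_of_card_antichain_le
    (h : ∀ A : Finset P, IsAntichain (· ≤ ·) (A : Set P) → #A ≤ k) :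
    ∃ f : P → P ⊕ Fin k, f.Injective ∧ ∀ u v, f u = .inl v → u < v := by
  classical
  cases nonempty_fintype P
  let t (u : P) : Finset (P ⊕ Fin k) := {v | u < v}.toFinset.disjSum univ
  suffices hall : ∀ X : Finset P, #X ≤ #(X.biUnion t) by
    obtain ⟨f, hf, hft⟩ := (Finset.all_card_le_biUnion_card_iff_exists_injective t).1 hall
    exact ⟨f, hf, fun u v huv ↦ by simpa [huv, t] using hft u⟩
  intro X
  rcases X.eq_empty_or_nonempty with rfl | ⟨x, hx⟩
  · simp
  let M := X.filter fun m ↦ ∀ u ∈ X, ¬ u < m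
  have hM : IsAntichain (· ≤ ·) (M : Set P) := fun a ha b hb hab hle ↦
    (mem_filter.1 hb).2 a (mem_filter.1 ha).1 (hle.lt_of_ne hab)
  have hsub : (X \ M).disjSum (univ : Finset (Fin k)) ⊆ X.biUnion t := by
    rintro (v | i) hv
    · obtain ⟨u, hu, huv⟩ : ∃ u ∈ X, u < v := by
        by_contra! hcon
        have hvM : v ∈ X \ M := inl_mem_disjSum.1 hv
        grind
      exact mem_biUnion.2 ⟨u, hu, by simp [t, huv]⟩
    · exact mem_biUnion.2 ⟨x, hx, by simp [t]⟩
  have hcard := card_le_card hsub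
  rw [card_disjSum, card_univ, Fintype.card_fin] at hcard
  have hdiff : #(X \ M) + #M = #X := card_sdiff_add_card_eq_card (filter_subset _ X)
  have hMk : #M ≤ k := h M hM
  omega

theorem incompGraph_colorable (h : ∀ A : Finset P, IsAntichain (· ≤ ·) (A : Set P) → #A ≤ k) :
    (incompGraph P).Colorable k := by
  obtain ⟨f, hf, hlt⟩ := exists_injective_lt_of_card_antichain_le h
  let R (u v : P) : Prop := f u = .inl v
  have hle {u v : P} (huv : Relation.ReflTransGen R u v) : u ≤ v := by
    induction huv with
    | refl => exact le_rfl
    | tail _ h ih => exact ih.trans (hlt _ _ h).le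
  have hexit (u : P) : ∃ i w, Relation.ReflTransGen R u w ∧ f w = .inr i := by
    induction u using WellFoundedGT.induction with
    | ind u ih =>
      rcases hu : f u with v | i
      · obtain ⟨i, w, hvw, hw⟩ := ih v (hlt u v hu)
        exact ⟨i, w, hvw.head hu, hw⟩
      · exact ⟨i, u, .refl, hu⟩
  choose color last hlast hcolor using hexit
  refine ⟨SimpleGraph.Coloring.mk color fun {u v} huv hc ↦ ?_⟩
  have hw : last u = last v := hf (by rw [hcolor, hcolor, hc])
  have hunique : Relator.RightUnique (Function.swap R) := fun a b c hb hc ↦ hf (hb.trans hc.symm)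
  rcases Relation.ReflTransGen.total_of_right_unique hunique (hlast u).swap
    (hw ▸ (hlast v).swap) with h | h
  · exact huv.2 (hle (Relation.reflTransGen_swap.1 h))
  · exact huv.1 (hle (Relation.reflTransGen_swap.1 h))

theorem HasWidth.colorable (hP : HasWidth P k) : (incompGraph P).Colorable k :=
  incompGraph_colorable fun A hA ↦ hP.2 ⟨A, hA, rfl⟩

end Dilworth

section LinearExtensions

variable {P Q : Type*} [PartialOrder P] [PartialOrder Q]

/-- The linear extensions of `P`, that is, the type counted by `numLinearExtensions`. -/
abbrev LinExt (P : Type*) [PartialOrder P] : Type _ :=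
  {r : P → P → Prop // IsLinearOrder P r ∧ ∀ a b, a ≤ b → r a b}

/-- The linear extension of `P` pulled back along an injective map into a type that is linearly
ordered by `s`. -/
def LinExt.comap {ι : Type*} (f : P → ι) (hf : f.Injective) (s : ι → ι → Prop)
    (hs : IsLinearOrder ι s) (h : ∀ a b, a ≤ b → s (f a) (f b)) : LinExt P :=
  ⟨fun a b ↦ s (f a) (f b), hf.isLinearOrder_onFun s, h⟩

theorem numLinearExtensions_pos [Finite P] : 0 < numLinearExtensions P := by
  obtain ⟨r, hr, hle⟩ := extend_partialOrder ((· ≤ ·) : P → P → Prop)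
  have : Nonempty (LinExt P) := ⟨⟨r, hr, fun a b h ↦ hle a b h⟩⟩
  exact Nat.card_pos (α := LinExt P)

theorem numLinearExtensions_congr (e : P ≃o Q) :
    numLinearExtensions P = numLinearExtensions Q :=
  Nat.card_congr {
    toFun r := LinExt.comap e.symm e.symm.injective r.1 r.2.1
      fun _ _ h ↦ r.2.2 _ _ (e.symm.monotone h)
    invFun r := LinExt.comap e e.injective r.1 r.2.1 fun _ _ h ↦ r.2.2 _ _ (e.monotone h)
    left_inv r := by ext; simp [LinExt.comap]
    right_inv r := by ext; simp [LinExt.comap] }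

section AddMaximal

variable {S : Set P} {m m' : P}

open Classical in
/-- The linear extension of `insert m S` that puts the maximal element `m` on top of a given linear
extension of `S`. -/
def LinExt.insertTop (hm : ∀ v ∈ S, ¬ m ≤ v) (r : LinExt S) : LinExt ↥(insert m S) :=
  have hmS : m ∉ S := fun h ↦ hm m h le_rfl
  have := r.2.1
  LinExt.comap (Equiv.Set.insert hmS) (Equiv.injective _) (Sum.Lex r.1 (· ≤ ·)) {} <| by
    rintro ⟨a, rfl | ha⟩ ⟨b, rfl | hb⟩ hab
    · exact Std.Refl.refl _
    · exact absurd hab (hm b hb)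
    · lift a to S using ha
      simp
    · lift a to S using ha
      lift b to S using hb
      simpa using r.2.2 _ _ hab

theorem LinExt.insertTop_apply (hm : ∀ v ∈ S, ¬ m ≤ v) (r : LinExt S) (a b : S) :
    (insertTop hm r).1 ⟨a, .inr a.2⟩ ⟨b, .inr b.2⟩ ↔ r.1 a b := by
  simp [insertTop, LinExt.comap]

theorem LinExt.insertTop_apply_top (hm : ∀ v ∈ S, ¬ m ≤ v) (r : LinExt S) (v : ↥(insert m S)) :
    (insertTop hm r).1 v ⟨m, .inl rfl⟩ := by
  classical
  obtain ⟨v, rfl | hv⟩ := v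
  · exact (insertTop hm r).2.2 _ _ le_rfl
  · lift v to S using hv
    simp [insertTop, LinExt.comap]

theorem LinExt.insertTop_injective (hm : ∀ v ∈ S, ¬ m ≤ v) : (insertTop hm).Injective :=
  fun r s hrs ↦ by
    ext a b
    rw [← insertTop_apply hm, hrs, insertTop_apply]

theorem numLinearExtensions_le_ncard_top [Finite P] {T : Set P} (hT : T = insert m S)
    (hm : ∀ v ∈ S, ¬ m ≤ v) (hmT : m ∈ T) :
    numLinearExtensions S ≤ {r : LinExt T | ∀ v, r.1 v ⟨m, hmT⟩}.ncard := by
  subst hT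
  rw [← Nat.card_coe_set_eq]
  refine Nat.card_le_card_of_injective
    (fun r : LinExt S ↦ ⟨LinExt.insertTop hm r, LinExt.insertTop_apply_top hm r⟩) fun r s hrs ↦ ?_
  exact LinExt.insertTop_injective hm (congrArg Subtype.val hrs)

theorem numLinearExtensions_le_insert [Finite P] (hm : ∀ v ∈ S, ¬ m ≤ v) :
    numLinearExtensions S ≤ numLinearExtensions ↥(insert m S) :=
  Nat.card_le_card_of_injective _ (LinExt.insertTop_injective hm)

theorem numLinearExtensions_insert_add_le [Finite P] (hm : ∀ v ∈ S, ¬ m ≤ v)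
    (hm' : ∀ v ∈ S, ¬ m' ≤ v) (h : IncompRel (· ≤ ·) m m') :
    numLinearExtensions ↥(insert m S) + numLinearExtensions ↥(insert m' S) ≤
      numLinearExtensions ↥(insert m (insert m' S)) := by
  set T : Set P := insert m (insert m' S) with hT
  have hmT : m ∈ T := .inl rfl
  have hmT' : m' ∈ T := .inr (.inl rfl)
  have hle : numLinearExtensions ↥(insert m' S) ≤ {r : LinExt T | ∀ v, r.1 v ⟨m, hmT⟩}.ncard :=
    numLinearExtensions_le_ncard_top hT (by rintro v (rfl | hv); exacts [h.1, hm v hv]) hmT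
  have hle' : numLinearExtensions ↥(insert m S) ≤ {r : LinExt T | ∀ v, r.1 v ⟨m', hmT'⟩}.ncard :=
    numLinearExtensions_le_ncard_top (hT.trans (Set.insert_comm ..))
      (by rintro v (rfl | hv); exacts [h.2, hm' v hv]) hmT'
  have hdisj : Disjoint {r : LinExt T | ∀ v, r.1 v ⟨m', hmT'⟩}
      {r : LinExt T | ∀ v, r.1 v ⟨m, hmT⟩} :=
    Set.disjoint_left.2 fun r hr hr' ↦ h.ne <| congrArg Subtype.val <|
      r.2.1.antisymm ⟨m, hmT⟩ ⟨m', hmT'⟩ (hr _) (hr' _)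
  calc _ ≤ _ := add_le_add hle' hle
    _ = _ := (Set.ncard_union_eq hdisj).symm
    _ ≤ numLinearExtensions T := Set.ncard_le_card _

end AddMaximal

theorem prod_numLinearExtensions_preimage_le [Finite P] {ι : Type*} [LinearOrder ι] [Fintype ι]
    (f : P →o ι) : ∏ i, numLinearExtensions ↥(f ⁻¹' {i}) ≤ numLinearExtensions P := by
  let toSigma (v : P) : Σ i, ↥(f ⁻¹' {i}) := ⟨f v, v, rfl⟩
  have hinj : toSigma.Injective := fun u v h ↦ congrArg (fun s ↦ s.2.1) h
  have toSigma_coe (i) (v : ↥(f ⁻¹' {i})) : toSigma v = ⟨i, v⟩ := by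
    obtain ⟨v, rfl⟩ := v
    rfl
  have hlex (r : ∀ i, LinExt ↥(f ⁻¹' {i})) :
      IsLinearOrder _ (Sigma.Lex (· < ·) fun i ↦ (r i).1) := by
    have := fun i ↦ (r i).2.1
    exact {}
  have hmono (r : ∀ i, LinExt ↥(f ⁻¹' {i})) (u v : P) (huv : u ≤ v) :
      Sigma.Lex (· < ·) (fun i ↦ (r i).1) (toSigma u) (toSigma v) := by
    rcases (f.monotone huv).lt_or_eq with h | h
    · exact .left _ _ h
    · lift u to ↥(f ⁻¹' {f v}) using h
      rw [toSigma_coe]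
      exact .right _ _ ((r _).2.2 u ⟨v, rfl⟩ huv)
  have hprod : Nat.card (∀ i, LinExt ↥(f ⁻¹' {i})) = ∏ i, numLinearExtensions ↥(f ⁻¹' {i}) :=
    Nat.card_pi
  rw [← hprod]
  refine Nat.card_le_card_of_injective
    (fun r ↦ LinExt.comap toSigma hinj _ (hlex r) (hmono r)) fun r s hrs ↦ ?_
  ext i u v
  have huv : Sigma.Lex (· < ·) (fun i ↦ (r i).1) (toSigma u) (toSigma v) =
      Sigma.Lex (· < ·) (fun i ↦ (s i).1) (toSigma u) (toSigma v) :=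
    congrFun (congrFun (congrArg Subtype.val hrs) u) v
  rw [toSigma_coe, toSigma_coe] at huv
  simpa [Sigma.lex_iff] using huv

end LinearExtensions

section Components

open SimpleGraph

variable {P : Type*} [PartialOrder P]

theorem lt_or_lt_of_not_reachable {a b : P} (h : ¬ (incompGraph P).Reachable a b) :
    a < b ∨ b < a := by
  by_contra! hcon
  have hne : a ≠ b := fun hab ↦ h (hab ▸ .refl a)
  exact h (Adj.reachable ⟨fun hab ↦ hcon.1 (hab.lt_of_ne hne),
    fun hba ↦ hcon.2 (hba.lt_of_ne hne.symm)⟩)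

theorem lt_of_reachable {a b c : P} (h : (incompGraph P).Reachable a b)
    (hc : ¬ (incompGraph P).Reachable a c) (hca : c < a) : c < b := by
  obtain ⟨p⟩ := h
  induction p with
  | nil => exact hca
  | @cons u v _ huv _ ih =>
    have hvc : ¬ (incompGraph P).Reachable v c := fun h ↦ hc (huv.reachable.trans h)
    refine ih hvc ((lt_or_lt_of_not_reachable hvc).resolve_left fun hlt ↦ ?_)
    exact huv.2 (hlt.trans hca).le

namespace ComponentOrder

/-- The elements below every element of the component `C`. Distinct components are comparable
elementwise, so the sizes of these sets order the components. -/
def below (C : (incompGraph P).ConnectedComponent) : Set P := {v | ∀ a ∈ C.supp, v < a}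

theorem below_ssubset {a b : P} (hab : a < b) (h : ¬ (incompGraph P).Reachable a b) :
    below ((incompGraph P).connectedComponentMk a) ⊂
      below ((incompGraph P).connectedComponentMk b) := by
  have ha : ∀ b', (incompGraph P).Reachable b' b → a < b' := fun b' hb' ↦
    lt_of_reachable hb'.symm (fun h' ↦ h h'.symm) hab
  simp only [below, ConnectedComponent.mem_supp_iff, ConnectedComponent.eq]
  exact ⟨fun v hv b' hb' ↦ (hv a (.refl a)).trans (ha b' hb'),
    fun hsub ↦ (hsub ha a (.refl a)).false⟩

variable [Finite P]

theorem ncard_below_injective :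
    (fun C : (incompGraph P).ConnectedComponent ↦ (below C).ncard).Injective := by
  rintro ⟨a⟩ ⟨b⟩ hab
  by_contra hne
  have h : ¬ (incompGraph P).Reachable a b := fun h ↦ hne (ConnectedComponent.sound h)
  rcases lt_or_lt_of_not_reachable h with hlt | hlt
  · exact (Set.ncard_lt_ncard (below_ssubset hlt h)).ne hab
  · exact (Set.ncard_lt_ncard (below_ssubset hlt fun h' ↦ h h'.symm)).ne' hab

scoped instance : LinearOrder (incompGraph P).ConnectedComponent :=
  LinearOrder.lift' _ ncard_below_injective

theorem monotone_connectedComponentMk : Monotone (incompGraph P).connectedComponentMk := by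
  intro a b hab
  by_cases h : (incompGraph P).Reachable a b
  · exact (ConnectedComponent.sound h).le
  · have hlt : a < b := hab.lt_of_ne fun hab ↦ h (hab ▸ .refl a)
    exact (Set.ncard_lt_ncard (below_ssubset hlt h)).le

end ComponentOrder

open ComponentOrder in
theorem prod_numLinearExtensions_supp_le [Finite P]
    [Fintype (incompGraph P).ConnectedComponent] :
    ∏ C : (incompGraph P).ConnectedComponent, numLinearExtensions C.supp ≤
      numLinearExtensions P :=
  prod_numLinearExtensions_preimage_le ⟨_, ComponentOrder.monotone_connectedComponentMk⟩

end Components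

section StableSetPolytope

open MeasureTheory

variable {V : Type*} {G : SimpleGraph V} {x : V → ℝ}

/-- The polytope cut out of the unit cube by the edge inequalities `x u + x v ≤ 1`. It contains the
stable set polytope, and equals it when the graph is bipartite. -/
def edgePolytope (G : SimpleGraph V) : Set (V → ℝ) :=
  {x | (∀ v, x v ∈ Set.Icc 0 1) ∧ ∀ u v, G.Adj u v → x u + x v ≤ 1}

theorem const_mem_edgePolytope {c : ℝ} (h0 : 0 ≤ c) (h1 : c ≤ 1 / 2) :
    (fun _ ↦ c) ∈ edgePolytope G :=
  ⟨fun _ ↦ ⟨h0, by linarith⟩, fun _ _ _ ↦ by linarith⟩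

theorem convex_edgePolytope : Convex ℝ (edgePolytope G) := by
  rintro x hx y hy a b ha hb hab
  refine ⟨fun v ↦ convex_Icc 0 1 (hx.1 v) (hy.1 v) ha hb hab, fun u v huv ↦ ?_⟩
  simp only [Pi.add_apply, Pi.smul_apply, smul_eq_mul]
  nlinarith [hx.2 u v huv, hy.2 u v huv]

theorem stab_subset_edgePolytope : stab G ⊆ edgePolytope G := by
  classical
  refine convexHull_min ?_ convex_edgePolytope
  rintro _ ⟨S, hS, rfl⟩
  refine ⟨fun v ↦ ?_, fun u v huv ↦ ?_⟩
  · simp only [Set.indicator_apply, Pi.one_apply]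
    split_ifs <;> simp
  · have hST (hu : u ∈ S) (hv : v ∈ S) : False := hS hu hv huv.ne huv
    simp only [Set.indicator_apply, Pi.one_apply]
    split_ifs with hu hv <;> norm_num
    exact hST hu hv

/- A uniform threshold `θ` in `(0, 1]` selects the stable set of those `v` with `θ ≤ x v` in one
colour class and `1 - x v < θ` in the other; it contains `v` with probability `x v`. -/
theorem edgePolytope_subset_stab [Finite V] (c : G.Coloring Bool) : edgePolytope G ⊆ stab G := by
  cases nonempty_fintype V
  intro x hx
  let T (v : V) : Set ℝ := bif c v then Set.Iic (x v) else Set.Ioi (1 - x v)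
  have hT (v) : MeasurableSet (T v) := by
    cases h : c v <;> simp [T, h]
  have hindep (θ : ℝ) : G.IsIndepSet {v | θ ∈ T v} := by
    intro u hu v hv _ huv
    have hc := c.valid huv
    have hx := hx.2 u v huv
    cases hcu : c u <;> cases hcv : c v <;> simp_all [T] <;> linarith
  let μ : Measure ℝ := volume.restrict (Set.Ioc 0 1)
  have : IsProbabilityMeasure μ := ⟨by simp [μ]⟩
  have hμ (v) : μ.real (T v) = x v := by
    obtain ⟨h0, h1⟩ := hx.1 v
    rw [measureReal_restrict_apply (hT v), Set.inter_comm]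
    cases h : c v <;> simp [T, h, Set.Ioc_inter_Iic, Set.Ioc_inter_Ioi, h0, h1]
  let f (θ : ℝ) (v : V) : ℝ := (T v).indicator 1 θ
  have hf (v) : Integrable (fun θ ↦ f θ v) μ := (integrable_const (1 : ℝ)).indicator (hT v)
  have hint : ∫ θ, f θ ∂μ = x := by
    funext v
    rw [eval_integral hf, ← hμ v]
    exact integral_indicator_one (hT v)
  rw [← hint]
  exact (convex_convexHull ℝ _).integral_mem (isCompact_stab G).isClosed
    (.of_forall fun θ ↦ subset_convexHull ℝ _ ⟨{v | θ ∈ T v}, hindep θ, rfl⟩) (.of_eval hf)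

end StableSetPolytope

section Entropy

variable {V : Type*} [Fintype V] {G : SimpleGraph V} {x : V → ℝ}

theorem card_mul_entropyObjective (x : V → ℝ) :
    (Fintype.card V : ℝ) * entropyObjective x = ∑ v, -Real.logb 2 (x v) := by
  cases isEmpty_or_nonempty V
  · simp
  · rw [entropyObjective, ← mul_sum, sum_neg_distrib]
    field_simp

theorem card_mul_graphEntropy_le (hx : x ∈ stab G) (hpos : ∀ v, 0 < x v) :
    Fintype.card V * graphEntropy G ≤ ∑ v, -Real.logb 2 (x v) := by
  rw [← card_mul_entropyObjective]
  gcongr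
  exact (graphEntropy_isLeast G).2 ⟨x, ⟨hx, hpos⟩, rfl⟩

theorem exists_card_mul_graphEntropy_eq (G : SimpleGraph V) :
    ∃ x ∈ stab G, (∀ v, 0 < x v) ∧ Fintype.card V * graphEntropy G = ∑ v, -Real.logb 2 (x v) := by
  obtain ⟨x, ⟨hx, hpos⟩, hG⟩ := (graphEntropy_isLeast G).1
  exact ⟨x, hx, hpos, by rw [← hG, card_mul_entropyObjective]⟩

end Entropy

section EntropyComponents

open SimpleGraph

variable {V : Type*} {G : SimpleGraph V}

theorem glue_mem_stab [Finite V] {x : ∀ C : G.ConnectedComponent, C.supp → ℝ}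
    (hx : ∀ C, x C ∈ stab (G.induce C.supp)) :
    (fun v ↦ x (G.connectedComponentMk v) ⟨v, rfl⟩) ∈ stab G := by
  let glue : (∀ C : G.ConnectedComponent, C.supp → ℝ) →ₗ[ℝ] V → ℝ :=
    { toFun x v := x (G.connectedComponentMk v) ⟨v, rfl⟩
      map_add' _ _ := rfl
      map_smul' _ _ := rfl }
  have hx' : x ∈ convexHull ℝ (Set.univ.pi fun C : G.ConnectedComponent ↦
      {x : C.supp → ℝ | ∃ S : Set C.supp, (G.induce C.supp).IsIndepSet S ∧ x = S.indicator 1}) := by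
    rw [convexHull_pi]
    exact fun C _ ↦ hx C
  have hglue := Set.mem_image_of_mem glue hx'
  rw [LinearMap.image_convexHull] at hglue
  refine convexHull_mono ?_ hglue
  rintro _ ⟨y, hy, rfl⟩
  choose S hS hyS using fun C ↦ hy C trivial
  refine ⟨{v | (⟨v, rfl⟩ : (G.connectedComponentMk v).supp) ∈ S _}, ?_, ?_⟩
  · have mem_of_mem (v : V) (hv : ⟨v, rfl⟩ ∈ S (G.connectedComponentMk v)) :
        ∀ C (h : v ∈ C.supp), ⟨v, h⟩ ∈ S C := by
      rintro _ rfl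
      exact hv
    intro u hu v hv huv hadj
    have hC : G.connectedComponentMk u = G.connectedComponentMk v :=
      ConnectedComponent.sound hadj.reachable
    exact hS _ (mem_of_mem u hu _ hC) hv (fun h ↦ huv (congrArg Subtype.val h)) hadj
  · funext v
    simp only [glue, LinearMap.coe_mk, AddHom.coe_mk, hyS]
    rfl

theorem card_mul_graphEntropy_le_sum_components [Fintype V] [Fintype G.ConnectedComponent]
    [∀ C : G.ConnectedComponent, Fintype C.supp] :
    Fintype.card V * graphEntropy G ≤
      ∑ C : G.ConnectedComponent, Fintype.card C.supp * graphEntropy (G.induce C.supp) := by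
  choose x hx hpos hsum using fun C : G.ConnectedComponent ↦
    exists_card_mul_graphEntropy_eq (G.induce C.supp)
  refine (card_mul_graphEntropy_le (glue_mem_stab hx) fun v ↦ hpos _ _).trans_eq ?_
  let e : (Σ C : G.ConnectedComponent, C.supp) ≃ V := Equiv.sigmaFiberEquiv G.connectedComponentMk
  rw [← e.sum_comp, Fintype.sum_sigma]
  refine sum_congr rfl fun C _ ↦ (sum_congr rfl ?_).trans (hsum C).symm
  rintro ⟨v, rfl⟩ -
  rfl

end EntropyComponents

section Optimality

open Filter Topology

theorem eventually_add_mul_le {a b c : ℝ} (h : a ≤ c) (hb : a = c → b ≤ 0) :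
    ∀ᶠ t : ℝ in 𝓝[>] 0, a + t * b ≤ c := by
  rcases h.lt_or_eq with hlt | heq
  · have hcont : ContinuousAt (fun t ↦ a + t * b) 0 := by fun_prop
    have hev := hcont.eventually_lt continuousAt_const (by simpa using hlt)
    exact nhdsWithin_le_nhds (hev.mono fun t ht ↦ ht.le)
  · filter_upwards [self_mem_nhdsWithin] with t (ht : 0 < t)
    linarith [mul_nonpos_of_nonneg_of_nonpos ht.le (hb heq)]

theorem eventually_add_smul_mem_edgePolytope {V : Type*} [Finite V] {G : SimpleGraph V}
    {x d : V → ℝ} (hx : x ∈ edgePolytope G) (h0 : ∀ v, x v = 0 → 0 ≤ d v)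
    (h1 : ∀ v, x v = 1 → d v ≤ 0) (hG : ∀ u v, G.Adj u v → x u + x v = 1 → d u + d v ≤ 0) :
    ∀ᶠ t : ℝ in 𝓝[>] 0, x + t • d ∈ edgePolytope G := by
  have hnonneg := eventually_all.2 fun v ↦ eventually_add_mul_le (b := -d v)
    (neg_nonpos.2 (hx.1 v).1) fun hv ↦ neg_nonpos.2 (h0 v (neg_eq_zero.1 hv))
  have hle_one := eventually_all.2 fun v ↦ eventually_add_mul_le (hx.1 v).2 (h1 v)
  have hedge := eventually_all.2 fun u ↦ eventually_all.2 fun v ↦ eventually_all.2 fun huv ↦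
    eventually_add_mul_le (hx.2 u v huv) (hG u v huv)
  filter_upwards [hnonneg, hle_one, hedge] with t ht0 ht1 htG
  refine ⟨fun v ↦ ⟨?_, ht1 v⟩, fun u v huv ↦ ?_⟩ <;>
    simp only [Pi.add_apply, Pi.smul_apply, smul_eq_mul]
  · linarith [ht0 v]
  · linarith [htG u v huv]

variable {V : Type*} [Fintype V] {G : SimpleGraph V} {x : V → ℝ}

/-- `x` is a positive point of `edgePolytope G` that maximizes the product of the coordinates. For
bipartite `G` these are the minimizers in the definition of the graph entropy. -/
structure IsOptimal (G : SimpleGraph V) (x : V → ℝ) : Prop where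
  mem : x ∈ edgePolytope G
  pos : ∀ v, 0 < x v
  sum_log_le : ∀ y ∈ edgePolytope G, (∀ v, 0 < y v) → ∑ v, Real.log (y v) ≤ ∑ v, Real.log (x v)

theorem exists_isOptimal (c : G.Coloring Bool) : ∃ x, IsOptimal G x := by
  obtain ⟨x, hx, hpos, hsum⟩ := exists_card_mul_graphEntropy_eq G
  refine ⟨x, stab_subset_edgePolytope hx, hpos, fun y hy hypos ↦ ?_⟩
  have hle := hsum.symm.trans_le (card_mul_graphEntropy_le (edgePolytope_subset_stab c hy) hypos)
  simp only [sum_neg_distrib, neg_le_neg_iff, Real.logb, ← sum_div] at hle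
  exact (div_le_div_iff_of_pos_right (Real.log_pos one_lt_two)).1 hle

namespace IsOptimal

theorem sum_div_nonpos (hx : IsOptimal G x) {d : V → ℝ}
    (hd : ∀ᶠ t : ℝ in 𝓝[>] 0, x + t • d ∈ edgePolytope G) : ∑ v, d v / x v ≤ 0 := by
  let F (t : ℝ) : ℝ := ∑ v, Real.log (x v + t * d v)
  have hF : HasDerivAt F (∑ v, d v / x v) 0 := by
    refine HasDerivAt.fun_sum fun v _ ↦ ?_
    have h : HasDerivAt (fun t : ℝ ↦ x v + t * d v) (d v) 0 := by
      simpa using ((hasDerivAt_id (0 : ℝ)).mul_const (d v)).const_add (x v)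
    simpa using h.log (by simpa using (hx.pos v).ne')
  have hpos : ∀ᶠ t : ℝ in 𝓝[>] 0, ∀ v, 0 < x v + t * d v := by
    refine eventually_all.2 fun v ↦ nhdsWithin_le_nhds ?_
    exact ContinuousAt.eventually_lt (by fun_prop) (by fun_prop) (by simpa using hx.pos v)
  refine le_of_tendsto hF.tendsto_slope_zero_right ?_
  filter_upwards [hd, hpos, self_mem_nhdsWithin] with t ht htpos (ht0 : 0 < t)
  have hle := hx.sum_log_le _ ht htpos
  refine mul_nonpos_of_nonneg_of_nonpos (by positivity) ?_
  simpa [F] using hle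

/- First-order optimality in the direction `1_S - 1_T`. -/
theorem sum_inv_le_sum_inv (hx : IsOptimal G x) {S T : Finset V} (hST : Disjoint S T)
    (hS : ∀ v ∈ S, x v < 1) (h : ∀ u ∈ S, ∀ v, G.Adj u v → x u + x v = 1 → v ∈ T) :
    ∑ v ∈ S, 1 / x v ≤ ∑ v ∈ T, 1 / x v := by
  classical
  let d (v : V) : ℝ := (if v ∈ S then 1 else 0) - if v ∈ T then 1 else 0
  have hsum : ∑ v, d v / x v = ∑ v ∈ S, 1 / x v - ∑ v ∈ T, 1 / x v := by
    simp [d, sub_div, sum_sub_distrib, ite_div]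
  have hT (v) (hv : v ∈ T) : d v = -1 := by
    simp [d, hv, disjoint_right.1 hST hv]
  have hd_nonpos (v) (hv : v ∉ S) : d v ≤ 0 := by
    simp only [d, if_neg hv]
    split_ifs <;> norm_num
  have hd_le_one (v) : d v ≤ 1 := by
    simp only [d]
    split_ifs <;> norm_num
  have hedge (u v) (huv : G.Adj u v) (htight : x u + x v = 1) : d u + d v ≤ 0 := by
    by_cases hu : u ∈ S
    · linarith [hT v (h u hu v huv htight), hd_le_one u]
    by_cases hv : v ∈ S
    · linarith [hT u (h v hv u huv.symm (by rwa [add_comm])), hd_le_one v]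
    linarith [hd_nonpos u hu, hd_nonpos v hv]
  have hd := eventually_add_smul_mem_edgePolytope hx.mem (d := d)
    (fun v hv ↦ absurd hv (hx.pos v).ne')
    (fun v hv ↦ hd_nonpos v fun hvS ↦ (hS v hvS).ne hv) hedge
  linarith [hx.sum_div_nonpos hd]

theorem exists_tight_adj (hx : IsOptimal G x) {v : V} (hv : x v < 1) :
    ∃ u, G.Adj v u ∧ x v + x u = 1 := by
  by_contra! hcon
  have hle := hx.sum_inv_le_sum_inv (S := {v}) (T := ∅) (disjoint_empty_right _)
    (by simpa using hv) (by simpa using hcon)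
  have := hx.pos v
  rw [sum_singleton, sum_empty] at hle
  exact absurd hle (not_le.2 (by positivity))

end IsOptimal

end Optimality

section TwoChains

variable {Q : Type*} [PartialOrder Q]

theorem exists_strictMonoOn_image_Iio_eq [Nonempty Q] {S : Set Q}
    (hS : IsChain (· ≤ ·) S) (hfin : S.Finite) :
    ∃ a : ℕ → Q, StrictMonoOn a (Set.Iio S.ncard) ∧ a '' Set.Iio S.ncard = S := by
  classical
  let : LinearOrder S := hS.linearOrder
  have := hfin.fintype
  let e : Fin S.ncard ≃o S := monoEquivOfFin S (Set.fintypeCard_eq_ncard S)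
  let a (i : ℕ) : Q := if h : i < S.ncard then e ⟨i, h⟩ else Classical.arbitrary Q
  have ha (i) (h : i < S.ncard) : a i = e ⟨i, h⟩ := dif_pos h
  refine ⟨a, fun i hi j hj hij ↦ ?_, Set.Subset.antisymm ?_ fun v hv ↦ ?_⟩
  · rw [ha i hi, ha j hj]
    exact e.strictMono (show (⟨i, hi⟩ : Fin _) < ⟨j, hj⟩ from hij)
  · rintro _ ⟨i, hi, rfl⟩
    simp [ha i hi]
  · exact ⟨e.symm ⟨v, hv⟩, (e.symm ⟨v, hv⟩).2, by simp [ha]⟩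

/-- A partition of a poset into the two chains `a 0 < ⋯ < a (p - 1)` and `b 0 < ⋯ < b (q - 1)`;
the values of `a` and `b` at larger indices are junk. -/
structure TwoChains (Q : Type*) [PartialOrder Q] where
  p : ℕ
  q : ℕ
  a : ℕ → Q
  b : ℕ → Q
  a_strictMonoOn : StrictMonoOn a (Set.Iio p)
  b_strictMonoOn : StrictMonoOn b (Set.Iio q)
  a_ne_b : ∀ i < p, ∀ j < q, a i ≠ b j
  cover : ∀ v, (∃ i < p, a i = v) ∨ ∃ j < q, b j = v

theorem nonempty_twoChains_of_coloring [Finite Q] [Nonempty Q]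
    (c : (incompGraph Q).Coloring Bool) : Nonempty (TwoChains Q) := by
  have hchain (t : Bool) : IsChain (· ≤ ·) {v | c v = t} := fun u hu v hv _ ↦ by
    by_contra! hcon
    exact c.valid (v := u) (w := v) ⟨hcon.1, hcon.2⟩ (hu.trans hv.symm)
  obtain ⟨a, ha, haS⟩ := exists_strictMonoOn_image_Iio_eq (hchain true) (Set.toFinite _)
  obtain ⟨b, hb, hbS⟩ := exists_strictMonoOn_image_Iio_eq (hchain false) (Set.toFinite _)
  refine ⟨⟨_, _, a, b, ha, hb, fun i hi j hj hij ↦ ?_, fun v ↦ ?_⟩⟩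
  · have hai : c (a i) = true := haS.subset ⟨i, hi, rfl⟩
    have hbj : c (b j) = false := hbS.subset ⟨j, hj, rfl⟩
    simp [hij, hbj] at hai
  · cases hv : c v
    · exact .inr (hbS.superset hv)
    · exact .inl (haS.superset hv)

namespace TwoChains

variable (D : TwoChains Q) {i i' j j' m s : ℕ}

/-- Exchanging the roles of the two chains. -/
@[simps]
def swap : TwoChains Q where
  p := D.q
  q := D.p
  a := D.b
  b := D.a
  a_strictMonoOn := D.b_strictMonoOn
  b_strictMonoOn := D.a_strictMonoOn
  a_ne_b j hj i hi := (D.a_ne_b i hi j hj).symm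
  cover v := (D.cover v).symm

theorem a_le_a (h : i ≤ i') (hi' : i' < D.p) : D.a i ≤ D.a i' :=
  D.a_strictMonoOn.monotoneOn (h.trans_lt hi') hi' h

theorem b_le_b (h : j ≤ j') (hj' : j' < D.q) : D.b j ≤ D.b j' :=
  D.swap.a_le_a h hj'

theorem not_adj_a_a (hi : i < D.p) (hi' : i' < D.p) : ¬ (incompGraph Q).Adj (D.a i) (D.a i') := by
  intro hadj
  rcases le_total i i' with h | h
  · exact hadj.1 (D.a_le_a h hi')
  · exact hadj.2 (D.a_le_a h hi)

theorem sum_eq [Fintype Q] (f : Q → ℝ) :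
    ∑ v, f v = ∑ i ∈ range D.p, f (D.a i) + ∑ j ∈ range D.q, f (D.b j) := by
  classical
  have huniv : univ = (range D.p).image D.a ∪ (range D.q).image D.b := by
    ext v
    simpa using D.cover v
  have hdisj : Disjoint ((range D.p).image D.a) ((range D.q).image D.b) := by
    simp only [disjoint_left, mem_image, mem_range]
    rintro _ ⟨i, hi, rfl⟩ ⟨j, hj, hij⟩
    exact D.a_ne_b i hi j hj hij.symm
  rw [huniv, sum_union hdisj, sum_image (by simpa using D.a_strictMonoOn.injOn),
    sum_image (by simpa using D.b_strictMonoOn.injOn)]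

/-- Incomparability of `a i` and `b j`. -/
def inc (i j : ℕ) : Prop := (incompGraph Q).Adj (D.a i) (D.b j)

variable {D}

theorem inc_swap : D.swap.inc j i ↔ D.inc i j :=
  (incompGraph Q).adj_comm _ _

theorem inc.of_le_of_le (h : D.inc i j') (h' : D.inc i' j) (him : i ≤ m) (hmi : m ≤ i')
    (hjs : j ≤ s) (hsj : s ≤ j') (hi' : i' < D.p) (hj' : j' < D.q) : D.inc m s :=
  ⟨fun hle ↦ h.1 ((D.a_le_a him (hmi.trans_lt hi')).trans (hle.trans (D.b_le_b hsj hj'))),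
    fun hle ↦ h'.2 ((D.b_le_b hjs (hsj.trans_lt hj')).trans (hle.trans (D.a_le_a hmi hi')))⟩

/- An edge that leaves the set of the elements up to `a i` and `b j` joins one chain below this
cut to the other chain above it. -/
theorem inc.succ_left_or_succ_right (hconn : (incompGraph Q).Preconnected) (hi : i + 1 < D.p)
    (hj : j + 1 < D.q) (h : D.inc i j) : D.inc (i + 1) j ∨ D.inc i (j + 1) := by
  let U : Set Q := D.a '' Set.Iic i ∪ D.b '' Set.Iic j
  have hnext : D.a (i + 1) ∉ U := by
    rintro (⟨k, hk : k ≤ i, hak⟩ | ⟨k, hk : k ≤ j, hbk⟩)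
    · exact (D.a_strictMonoOn (by grind) hi (show k < i + 1 by omega)).ne hak
    · exact D.a_ne_b (i + 1) hi k (by omega) hbk.symm
  obtain ⟨w⟩ := hconn (D.a i) (D.a (i + 1))
  obtain ⟨⟨⟨u, v⟩, huv⟩, -, hu, hv⟩ :=
    w.exists_boundary_dart U (.inl ⟨i, Set.self_mem_Iic, rfl⟩) hnext
  rcases hu with ⟨k, hk : k ≤ i, rfl⟩ | ⟨k, hk : k ≤ j, rfl⟩ <;>
    rcases D.cover v with ⟨m, hm, rfl⟩ | ⟨m, hm, rfl⟩
  · exact absurd huv (D.not_adj_a_a (by omega) hm)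
  · have hjm : j < m := by
      by_contra! hle
      exact hv (.inr ⟨m, hle, rfl⟩)
    exact .inr (inc.of_le_of_le huv h hk le_rfl (by omega) hjm (by omega) hm)
  · have him : i < m := by
      by_contra! hle
      exact hv (.inl ⟨m, hle, rfl⟩)
    exact .inl (inc.of_le_of_le h huv.symm (by omega) him hk le_rfl hm (by omega))
  · exact absurd huv (D.swap.not_adj_a_a (show k < D.q by omega) hm)

variable (D)

/-- The union of the first `i` elements of the first chain and the first `j` elements of the
second one. -/
def initial (i j : ℕ) : Set Q := D.a '' Set.Iio i ∪ D.b '' Set.Iio j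

theorem initial_swap (i j : ℕ) : D.swap.initial j i = D.initial i j :=
  Set.union_comm _ _

theorem initial_succ_left (i j : ℕ) : D.initial (i + 1) j = insert (D.a i) (D.initial i j) := by
  rw [initial, initial, ← Order.succ_eq_add_one, Order.Iio_succ_eq_insert, Set.image_insert_eq,
    Set.insert_union]

theorem initial_succ_right (i j : ℕ) : D.initial i (j + 1) = insert (D.b j) (D.initial i j) := by
  rw [← initial_swap, initial_succ_left, initial_swap, swap_a]

/-- The number of linear extensions of `D.initial i j`, as a real number. -/
def count (i j : ℕ) : ℝ := numLinearExtensions (D.initial i j)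

theorem count_swap (i j : ℕ) : D.swap.count j i = D.count i j := by
  rw [count, initial_swap, count]

theorem count_eq_numLinearExtensions : D.count D.p D.q = numLinearExtensions Q := by
  have huniv : D.initial D.p D.q = Set.univ := Set.eq_univ_of_forall D.cover
  rw [count, huniv, numLinearExtensions_congr OrderIso.Set.univ]

variable {D}

theorem not_a_le_of_mem_initial (h : D.inc i j) (hi : i < D.p) (hj : j < D.q) {v : Q}
    (hv : v ∈ D.initial i j) : ¬ D.a i ≤ v := by
  rcases hv with ⟨k, hk : k < i, rfl⟩ | ⟨k, hk : k < j, rfl⟩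
  · exact (D.a_strictMonoOn (hk.trans hi) hi hk).not_ge
  · exact fun hle ↦ h.1 (hle.trans (D.b_le_b hk.le hj))

section Count

variable [Finite Q]

theorem one_le_count (D : TwoChains Q) (i j : ℕ) : 1 ≤ D.count i j := by
  exact Nat.one_le_cast.2 numLinearExtensions_pos

theorem count_le_count_succ_left (h : D.inc i j) (hi : i < D.p) (hj : j < D.q) :
    D.count i j ≤ D.count (i + 1) j := by
  rw [count, count, initial_succ_left]
  exact_mod_cast numLinearExtensions_le_insert fun v ↦ not_a_le_of_mem_initial h hi hj

theorem count_le_count_succ_right (h : D.inc i j) (hi : i < D.p) (hj : j < D.q) :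
    D.count i j ≤ D.count i (j + 1) := by
  simpa only [count_swap] using count_le_count_succ_left (inc_swap.2 h) hj hi

theorem count_add_count_le (h : D.inc i j) (hi : i < D.p) (hj : j < D.q) :
    D.count i (j + 1) + D.count (i + 1) j ≤ D.count (i + 1) (j + 1) := by
  have hb (v) (hv : v ∈ D.initial i j) : ¬ D.b j ≤ v :=
    not_a_le_of_mem_initial (D := D.swap) (inc_swap.2 h) hj hi (by rwa [initial_swap])
  have hle := numLinearExtensions_insert_add_le
    (fun v ↦ not_a_le_of_mem_initial h hi hj (v := v)) hb h
  rw [count, count, count, initial_succ_right, initial_succ_left, initial_succ_left,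
    initial_succ_right, add_comm]
  exact_mod_cast hle

end Count

/-- The sum of `1 / x` over the first `i` elements of the first chain. Writing the elements of the
chain as consecutive intervals of lengths `1 / x`, this is where the interval of `a i` starts. -/
def startA (D : TwoChains Q) (x : Q → ℝ) (i : ℕ) : ℝ := ∑ k ∈ range i, 1 / x (D.a k)

/-- The analogue of `startA` for the second chain. -/
def startB (D : TwoChains Q) (x : Q → ℝ) (j : ℕ) : ℝ := ∑ k ∈ range j, 1 / x (D.b k)

section Tight

variable {x : Q → ℝ} [Fintype Q] {i'' j'' : ℕ}

theorem exists_tight_of_startB_lt (hx : IsOptimal (incompGraph Q) x) (hx1 : ∀ v, x v < 1)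
    (hi : i ≤ D.p) (hj : j ≤ D.q) (h : D.startB x j < D.startA x i) :
    ∃ i' < i, ∃ j', j ≤ j' ∧ j' < D.q ∧ D.inc i' j' ∧ x (D.a i') + x (D.b j') = 1 := by
  classical
  by_contra! hcon
  let S : Finset Q := (range i).image D.a
  let T : Finset Q := (range j).image D.b
  have hS : ∑ v ∈ S, 1 / x v = D.startA x i :=
    sum_image (D.a_strictMonoOn.injOn.mono (by simpa using Set.Iio_subset_Iio hi))
  have hT : ∑ v ∈ T, 1 / x v = D.startB x j :=
    sum_image (D.b_strictMonoOn.injOn.mono (by simpa using Set.Iio_subset_Iio hj))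
  have hST : Disjoint S T := by
    simp only [S, T, disjoint_left, mem_image, mem_range]
    rintro _ ⟨k, hk, rfl⟩ ⟨l, hl, hkl⟩
    exact D.a_ne_b k (by omega) l (by omega) hkl.symm
  have hle := hx.sum_inv_le_sum_inv hST (fun v _ ↦ hx1 v) fun u hu v huv htight ↦ by
    simp only [S, T, mem_image, mem_range] at hu ⊢
    obtain ⟨k, hk, rfl⟩ := hu
    rcases D.cover v with ⟨l, hl, rfl⟩ | ⟨l, hl, rfl⟩
    · exact absurd huv (D.not_adj_a_a (by omega) hl)
    · refine ⟨l, ?_, rfl⟩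
      by_contra! hjl
      exact hcon k hk l hjl hl huv htight
  linarith

theorem exists_tight_inc (hx : IsOptimal (incompGraph Q) x) (hi : i < D.p) (h1 : x (D.a i) < 1) :
    ∃ j < D.q, D.inc i j ∧ x (D.a i) + x (D.b j) = 1 := by
  obtain ⟨v, hadj, htight⟩ := hx.exists_tight_adj h1
  rcases D.cover v with ⟨l, hl, rfl⟩ | ⟨l, hl, rfl⟩
  · exact absurd hadj (D.not_adj_a_a hi hl)
  · exact ⟨l, hl, hadj, htight⟩

theorem eq_of_tight (hx : IsOptimal (incompGraph Q) x) (hx1 : ∀ v, x v < 1) (hi' : i' ≤ i)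
    (hi'' : i ≤ i'') (hj : j'' ≤ j') (hp : i'' < D.p) (hq : j' < D.q) (h' : D.inc i' j')
    (htight' : x (D.a i') + x (D.b j') = 1) (h'' : D.inc i'' j'')
    (htight'' : x (D.a i'') + x (D.b j'') = 1) : x (D.a i) = x (D.a i'') := by
  have hle {k l : ℕ} (h : D.inc k l) : x (D.a k) + x (D.b l) ≤ 1 := hx.mem.2 _ _ h
  have hlow := hle (h'.of_le_of_le h'' le_rfl (hi'.trans hi'') le_rfl hj hp hq)
  have hhigh := hle (h'.of_le_of_le h'' (hi'.trans hi'') le_rfl hj le_rfl hp hq)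
  have hmid := hle (h'.of_le_of_le h'' hi' hi'' hj le_rfl hp hq)
  obtain ⟨s, hs, his, htight⟩ := exists_tight_inc hx (hi''.trans_lt hp) (hx1 _)
  have hge : x (D.a i'') + x (D.b s) ≤ 1 := by
    rcases le_total j'' s with hjs | hsj
    · exact hle (his.of_le_of_le h'' hi'' le_rfl hjs le_rfl hp hs)
    · linarith [hle (h'.of_le_of_le his le_rfl hi' le_rfl (hsj.trans hj) (hi''.trans_lt hp) hq)]
  linarith

theorem tight_of_overlap (hx : IsOptimal (incompGraph Q) x) (hx1 : ∀ v, x v < 1) (hi : i < D.p)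
    (hj : j < D.q) (hA : D.startA x i < D.startB x (j + 1))
    (hB : D.startB x j < D.startA x (i + 1)) : D.inc i j ∧ x (D.a i) + x (D.b j) = 1 := by
  obtain ⟨i', hi', j', hj', hq, h', htight'⟩ := exists_tight_of_startB_lt hx hx1 hi hj.le hB
  obtain ⟨j'', hj'', i'', hi'', hp, h'', htight''⟩ :=
    exists_tight_of_startB_lt (D := D.swap) hx hx1 hj hi.le hA
  rw [Nat.lt_add_one_iff] at hi' hj''
  rw [inc_swap] at h''
  rw [add_comm] at htight''
  have ha := eq_of_tight hx hx1 hi' hi'' (hj''.trans hj') hp hq h' htight' h'' htight''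
  have hb := eq_of_tight (D := D.swap) hx hx1 hj'' hj' (hi'.trans hi'') hq hp (inc_swap.2 h'')
    ((add_comm _ _).trans htight'') (inc_swap.2 h') ((add_comm _ _).trans htight')
  have hcorner := eq_of_tight hx hx1 le_rfl (hi'.trans hi'') (hj''.trans hj') hp hq h' htight' h''
    htight''
  simp only [swap_a] at hb
  exact ⟨h'.of_le_of_le h'' hi' hi'' hj'' hj' hp hq, by linarith⟩

theorem startA_le_startB (hx : IsOptimal (incompGraph Q) x) (hx1 : ∀ v, x v < 1) :
    D.startA x D.p ≤ D.startB x D.q := by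
  by_contra! hlt
  obtain ⟨-, -, j, hle, hlt, -⟩ := exists_tight_of_startB_lt hx hx1 le_rfl le_rfl hlt
  exact hle.not_gt hlt

end Tight

/-- The intervals of lengths `1 / x` of the two chains, each laid out consecutively from `0`, tile
the same segment, and overlapping intervals belong to incomparable elements whose values of `x` add
up to `1`. -/
structure IsTiling (D : TwoChains Q) (x : Q → ℝ) : Prop where
  pos : ∀ v, 0 < x v
  tight_of_overlap : ∀ i < D.p, ∀ j < D.q, D.startA x i < D.startB x (j + 1) →
    D.startB x j < D.startA x (i + 1) → D.inc i j ∧ x (D.a i) + x (D.b j) = 1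
  startA_eq_startB : D.startA x D.p = D.startB x D.q

end TwoChains

theorem IsOptimal.isTiling {x : Q → ℝ} [Fintype Q] (hx : IsOptimal (incompGraph Q) x)
    (hx1 : ∀ v, x v < 1) (D : TwoChains Q) : D.IsTiling x where
  pos := hx.pos
  tight_of_overlap _ hi _ hj := TwoChains.tight_of_overlap hx hx1 hi hj
  startA_eq_startB := le_antisymm (TwoChains.startA_le_startB hx hx1)
    (TwoChains.startA_le_startB (D := D.swap) hx hx1)

end TwoChains

section Comparison

namespace TwoChains

variable {Q : Type*} [PartialOrder Q] {D : TwoChains Q} {x : Q → ℝ} {w : ℝ → ℝ} {r : ℝ}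
  {i j k m : ℕ}

section Intervals

theorem startA_succ : D.startA x (i + 1) = D.startA x i + 1 / x (D.a i) :=
  sum_range_succ _ _

theorem startB_succ : D.startB x (j + 1) = D.startB x j + 1 / x (D.b j) :=
  sum_range_succ _ _

theorem startB_add_of_eq {c : ℝ} (h : ∀ s < m, x (D.b (j + s)) = c) :
    D.startB x (j + m) = D.startB x j + m / c := by
  have hrun : ∑ s ∈ range m, 1 / x (D.b (j + s)) = ∑ s ∈ range m, 1 / c :=
    sum_congr rfl fun s hs ↦ by rw [h s (mem_range.1 hs)]
  rw [startB, sum_range_add, hrun, sum_const, card_range, nsmul_eq_mul, mul_one_div, startB]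

namespace IsTiling

theorem swap (hT : D.IsTiling x) : D.swap.IsTiling x where
  pos := hT.pos
  tight_of_overlap j hj i hi hB hA := by
    obtain ⟨h, htight⟩ := hT.tight_of_overlap i hi j hj hA hB
    exact ⟨inc_swap.2 h, (add_comm _ _).trans htight⟩
  startA_eq_startB := hT.startA_eq_startB.symm

theorem startA_strictMono (hT : D.IsTiling x) : StrictMono (D.startA x) :=
  strictMono_nat_of_lt_succ fun i ↦ by
    rw [startA_succ]
    exact lt_add_of_pos_right _ (one_div_pos.2 (hT.pos _))

theorem startB_strictMono (hT : D.IsTiling x) : StrictMono (D.startB x) :=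
  hT.swap.startA_strictMono

theorem lt_q_of_startB_lt (hT : D.IsTiling x) (hi : i ≤ D.p) (h : D.startB x j < D.startA x i) :
    j < D.q := by
  refine hT.startB_strictMono.lt_iff_lt.1 (h.trans_le ?_)
  rw [← hT.startA_eq_startB]
  exact hT.startA_strictMono.monotone hi

theorem lt_p_of_startA_lt (hT : D.IsTiling x) (hj : j ≤ D.q) (h : D.startA x i < D.startB x j) :
    i < D.p :=
  hT.swap.lt_q_of_startB_lt hj h

theorem eq_p_iff_eq_q (hT : D.IsTiling x) (h : D.startA x i = D.startB x j) :
    i = D.p ↔ j = D.q := by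
  rw [← hT.startA_strictMono.injective.eq_iff, ← hT.startB_strictMono.injective.eq_iff, h,
    hT.startA_eq_startB]

theorem exists_startB_add_lt_and_le (hT : D.IsTiling x) (hi : i ≤ D.p)
    (h : D.startB x j < D.startA x i) :
    ∃ k, D.startB x (j + k) < D.startA x i ∧ D.startA x i ≤ D.startB x (j + k + 1) := by
  classical
  have hex : ∃ m, D.startA x i ≤ D.startB x (j + m) := by
    refine ⟨D.q - j, ?_⟩
    rw [Nat.add_sub_cancel' (hT.lt_q_of_startB_lt hi h).le, ← hT.startA_eq_startB]
    exact hT.startA_strictMono.monotone hi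
  obtain ⟨k, hk⟩ : ∃ k, Nat.find hex = k + 1 := Nat.exists_eq_succ_of_ne_zero fun h0 ↦
    h.not_ge (by simpa [h0] using Nat.find_spec hex)
  exact ⟨k, not_le.1 (Nat.find_min hex (by omega)),
    by simpa only [hk, ← add_assoc] using Nat.find_spec hex⟩

theorem tight_of_run (hT : D.IsTiling x) (hi : i < D.p) (hA : D.startA x i < D.startB x (j + 1))
    (hB : D.startB x (j + k) < D.startA x (i + 1)) {s : ℕ} (hs : s ≤ k) :
    D.inc i (j + s) ∧ x (D.b (j + s)) = 1 - x (D.a i) := by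
  have hmono := hT.startB_strictMono.monotone
  have hBs : D.startB x (j + s) < D.startA x (i + 1) := (hmono (by omega)).trans_lt hB
  obtain ⟨h, htight⟩ := hT.tight_of_overlap i hi _ (hT.lt_q_of_startB_lt hi hBs)
    (hA.trans_le (hmono (by omega))) hBs
  exact ⟨h, by linarith⟩

end IsTiling

theorem one_div_one_sub_lt_and_lt_two_mul {y : ℝ} (h : 1 / 3 < y) (h' : y < 1 / 2) :
    1 / (1 - y) < 1 / y ∧ 1 / y < 2 * (1 / (1 - y)) := by
  refine ⟨one_div_lt_one_div_of_lt (by linarith) (by linarith), ?_⟩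
  rw [mul_one_div, div_lt_div_iff₀ (by linarith) (by linarith)]
  linarith

theorem one_div_eq_div_one_sub {t : ℝ} (h0 : 0 < t) (h1 : t < 1) :
    1 / t = (1 / t - 1) / (1 - t) := by
  have := sub_pos.2 h1
  field_simp

end Intervals

section Count

variable [Finite Q]

theorem count_run (hi : i < D.p) (hj : j + k < D.q) (h : ∀ s ≤ k, D.inc i (j + s)) :
    D.count i (j + 1) ≤ D.count i (j + k + 1) ∧
      D.count (i + 1) j + k * D.count i (j + 1) ≤ D.count (i + 1) (j + k) := by
  induction k with
  | zero => simp
  | succ k ih =>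
    obtain ⟨hX, hY⟩ := ih (by omega) fun s hs ↦ h s (by omega)
    have hX' := count_le_count_succ_right (h (k + 1) le_rfl) hi hj
    have hY' := count_add_count_le (h k (by omega)) hi (by omega)
    simp only [← add_assoc] at hX' ⊢
    push_cast
    constructor <;> linarith

theorem count_succ_succ_of_inc_succ_left (hi : i + 1 < D.p) (hj : j + 1 < D.q) (h : D.inc i j)
    (h' : D.inc (i + 1) (j + 1)) (hl : D.inc (i + 1) j) :
    D.count i (j + 1) + D.count (i + 1) j ≤ D.count (i + 1) (j + 2) ∧
      D.count i (j + 1) + 2 * D.count (i + 1) j ≤ D.count (i + 2) (j + 1) := by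
  have h1 := count_add_count_le h (by omega) (by omega)
  have h2 := count_le_count_succ_left hl hi (by omega)
  have h3 := count_le_count_succ_right h' hi hj
  have h4 := count_add_count_le hl hi (by omega)
  constructor <;> linarith

theorem count_succ_succ (hconn : (incompGraph Q).Preconnected) (hi : i + 1 < D.p)
    (hj : j + 1 < D.q) (h : D.inc i j) (h' : D.inc (i + 1) (j + 1)) :
    D.count i (j + 1) + D.count (i + 1) j ≤ D.count (i + 1) (j + 2) ∧
      D.count i (j + 1) + D.count (i + 1) j ≤ D.count (i + 2) (j + 1) ∧
      (2 * D.count i (j + 1) + 3 * D.count (i + 1) j ≤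
          D.count (i + 1) (j + 2) + D.count (i + 2) (j + 1) ∨
        3 * D.count i (j + 1) + 2 * D.count (i + 1) j ≤
          D.count (i + 1) (j + 2) + D.count (i + 2) (j + 1)) := by
  have hX := D.one_le_count i (j + 1)
  have hY := D.one_le_count (i + 1) j
  rcases h.succ_left_or_succ_right hconn hi hj with hl | hr
  · obtain ⟨h1, h2⟩ := count_succ_succ_of_inc_succ_left hi hj h h' hl
    exact ⟨h1, by linarith, .inl (by linarith)⟩
  · obtain ⟨h1, h2⟩ := count_succ_succ_of_inc_succ_left (D := D.swap) hj hi (inc_swap.2 h)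
      (inc_swap.2 h') (inc_swap.2 hr)
    simp only [count_swap] at h1 h2
    exact ⟨by linarith, by linarith, .inr (by linarith)⟩

end Count

end TwoChains

end Comparison

section Comparison

/-- The properties of a weight function `w` on `(0, 1)` under which the weight of a connected poset
of width two that is not a pair is at most its number of linear extensions. The last one concerns
an element with a value `y ≤ 1 / 3` that overlaps with `m` elements of the other chain. -/
structure IsWeight (w : ℝ → ℝ) (r : ℝ) : Prop where
  pos : ∀ y, 0 < w y
  eq_of_lt_of_lt : ∀ y, 1 / 3 < y → y < 2 / 3 → w y = r
  const_pos : 0 < r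
  pow_four_le : r ^ 4 ≤ 5
  star : ∀ (y : ℝ) (m : ℕ), 0 < y → y ≤ 1 / 3 → 1 / y - 2 < m → m < 1 / y →
    w y * w (1 - y) ^ m ≤ m + 1 ∧ r ^ 2 * (w y * w (1 - y) ^ m) ≤ 2 * m + 3 ∧
      r ^ 4 * (w y * w (1 - y) ^ m) ≤ 4 * m + 8

namespace IsWeight

variable {w : ℝ → ℝ} {r : ℝ}

theorem sq_le (hw : IsWeight w r) : r ^ 2 ≤ 2237 / 1000 := by
  nlinarith [hw.pow_four_le]

theorem const_le (hw : IsWeight w r) : r ≤ 1496 / 1000 := by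
  nlinarith [hw.sq_le, hw.const_pos]

theorem cube_le (hw : IsWeight w r) : r ^ 3 ≤ 34 / 10 := by
  have := mul_le_mul hw.sq_le hw.const_le hw.const_pos.le (by norm_num)
  linarith [pow_succ r 2]

end IsWeight

namespace TwoChains

variable {Q : Type*} [PartialOrder Q] {D : TwoChains Q} {x : Q → ℝ} {w : ℝ → ℝ} {r : ℝ}
  {i j k m : ℕ}

/-- The product of the weights of the elements of `D.initial i j`. -/
def prefixWeight (D : TwoChains Q) (x : Q → ℝ) (w : ℝ → ℝ) (i j : ℕ) : ℝ :=
  (∏ k ∈ range i, w (x (D.a k))) * ∏ k ∈ range j, w (x (D.b k))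

theorem prefixWeight_succ_left :
    D.prefixWeight x w (i + 1) j = D.prefixWeight x w i j * w (x (D.a i)) := by
  rw [prefixWeight, prefixWeight, prod_range_succ]
  ring

theorem prefixWeight_succ_right :
    D.prefixWeight x w i (j + 1) = D.prefixWeight x w i j * w (x (D.b j)) := by
  rw [prefixWeight, prefixWeight, prod_range_succ, mul_assoc]

theorem prefixWeight_swap : D.swap.prefixWeight x w j i = D.prefixWeight x w i j :=
  mul_comm _ _

theorem prefixWeight_pos (hw : IsWeight w r) : 0 < D.prefixWeight x w i j :=
  mul_pos (prod_pos fun _ _ ↦ hw.pos _) (prod_pos fun _ _ ↦ hw.pos _)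

theorem prefixWeight_add_of_eq {c : ℝ} (h : ∀ s < m, x (D.b (j + s)) = c) :
    D.prefixWeight x w i (j + m) = D.prefixWeight x w i j * w c ^ m := by
  have hrun : ∏ s ∈ range m, w (x (D.b (j + s))) = ∏ _s ∈ range m, w c :=
    prod_congr rfl fun s hs ↦ by rw [h s (mem_range.1 hs)]
  rw [prefixWeight, prod_range_add, hrun, prod_const, card_range, prefixWeight, mul_assoc]

/-- The comparison between weights and linear extensions, which fails only for an incomparable
pair. -/
def WeightBound (D : TwoChains Q) (x : Q → ℝ) (w : ℝ → ℝ) : Prop :=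
  D.p = 1 ∧ D.q = 1 ∨ D.prefixWeight x w D.p D.q ≤ D.count D.p D.q

theorem WeightBound.of_swap (h : D.swap.WeightBound x w) : D.WeightBound x w := by
  rwa [WeightBound, prefixWeight_swap, count_swap, and_comm] at h

/-- The comparison at the overlapping elements `a i` and `b j`. The linear extensions of
`D.initial (i + 1) (j + 1)` are split according to their top element, and the last two inequalities
anticipate the factor `r ^ 2` of the next pair. -/
structure Completed (D : TwoChains Q) (x : Q → ℝ) (w : ℝ → ℝ) (r : ℝ) (i j : ℕ) : Prop where
  le : D.prefixWeight x w (i + 1) (j + 1) ≤ D.count i (j + 1) + D.count (i + 1) j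
  sq_mul_le : r ^ 2 * D.prefixWeight x w (i + 1) (j + 1) ≤
    3 * D.count i (j + 1) + 2 * D.count (i + 1) j
  sq_mul_le' : r ^ 2 * D.prefixWeight x w (i + 1) (j + 1) ≤
    2 * D.count i (j + 1) + 3 * D.count (i + 1) j

/-- The comparison when the intervals of `a i` and `b j` start at a common point: nothing precedes
them, or a pair of elements with weight `r` precedes them, or what precedes them is completed. -/
inductive Opened (D : TwoChains Q) (x : Q → ℝ) (w : ℝ → ℝ) (r : ℝ) (i j : ℕ) : Prop
  | start (hi : i = 0) (hj : j = 0)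
  | pair (eq_sq : D.prefixWeight x w i j = r ^ 2) (two_le : 2 ≤ D.count i (j + 1))
      (two_le' : 2 ≤ D.count (i + 1) j) (five_le : 5 ≤ D.count i (j + 1) + D.count (i + 1) j)
  | completed (le : D.prefixWeight x w i j ≤ D.count i (j + 1))
      (le' : D.prefixWeight x w i j ≤ D.count (i + 1) j)
      (sq_mul_le : r ^ 2 * D.prefixWeight x w i j ≤ D.count i (j + 1) + D.count (i + 1) j)

theorem Opened.swap (h : D.Opened x w r i j) : D.swap.Opened x w r j i := by
  rcases h with ⟨hi, hj⟩ | ⟨heq, hX, hY, hXY⟩ | ⟨hX, hY, hXY⟩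
  · exact .start hj hi
  · exact .pair (by rwa [prefixWeight_swap]) (by rwa [count_swap]) (by rwa [count_swap])
      (by simpa only [count_swap, add_comm] using hXY)
  · exact .completed (by rwa [prefixWeight_swap, count_swap])
      (by rwa [prefixWeight_swap, count_swap])
      (by simpa only [prefixWeight_swap, count_swap, add_comm] using hXY)

/-- The situations between which the comparison moves on: the intervals of `a i` and `b j` start
together; the interval of `a i` ends strictly inside that of `b j`, where `x (b j)` is large; or the
interval of `a i` starts strictly inside that of `b j`, where both values of `x` are moderate. -/
inductive State (D : TwoChains Q) (x : Q → ℝ) (w : ℝ → ℝ) (r : ℝ) (i j : ℕ) : Prop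
  | opened (h : D.startA x i = D.startB x j) (hO : D.Opened x w r i j)
  | shared (h : D.startB x j < D.startA x (i + 1)) (h' : D.startA x (i + 1) < D.startB x (j + 1))
      (hb : 2 / 3 ≤ x (D.b j)) (hC : D.Completed x w r i j)
  | alternating (h : D.startB x j < D.startA x i) (h' : D.startA x i < D.startB x (j + 1))
      (ha : 1 / 3 < x (D.a i)) (ha' : x (D.a i) < 1 / 2)
      (le_two_mul : D.prefixWeight x w (i + 1) (j + 1) ≤ 2 * D.count i (j + 1))
      (le : D.prefixWeight x w (i + 1) (j + 1) ≤ D.count i (j + 1) + D.count (i + 1) j)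

/-- The comparison is finished, or it reaches a state further on than `i` and `j`. -/
def Advances (D : TwoChains Q) (x : Q → ℝ) (w : ℝ → ℝ) (r : ℝ) (i j : ℕ) : Prop :=
  D.WeightBound x w ∨ ∃ i' < D.p, ∃ j' < D.q, i + j < i' + j' ∧ D.State x w r i' j'

theorem Advances.of_le {i' j' : ℕ} (h : D.Advances x w r i' j') (hle : i + j ≤ i' + j') :
    D.Advances x w r i j :=
  h.imp_right fun ⟨i₁, hi₁, j₁, hj₁, hlt, hS⟩ ↦ ⟨i₁, hi₁, j₁, hj₁, by omega, hS⟩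

theorem IsTiling.one_div_sub_two_lt_and_lt_one_div (hT : D.IsTiling x)
    (hrun : ∀ s ≤ k, x (D.b (j + s)) = 1 - x (D.a i)) (hB : D.startB x j < D.startA x i)
    (hA : D.startA x i < D.startB x (j + 1)) (hBk : D.startB x (j + k) < D.startA x (i + 1))
    (hAk : D.startA x (i + 1) ≤ D.startB x (j + k + 1)) :
    1 / x (D.a i) - 2 < k ∧ k < 1 / x (D.a i) := by
  have hb := hrun 0 k.zero_le
  rw [add_zero] at hb
  have hb0 := hT.pos (D.b j)
  rw [hb] at hb0
  have hlen := one_div_eq_div_one_sub (hT.pos (D.a i)) (by linarith)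
  constructor
  · rw [startA_succ, add_assoc j, startB_add_of_eq fun s hs ↦ hrun s (Nat.lt_succ_iff.1 hs),
      hlen] at hAk
    have h : (1 / x (D.a i) - 1) / (1 - x (D.a i)) < (k + 1 : ℕ) / (1 - x (D.a i)) := by linarith
    rw [div_lt_div_iff_of_pos_right hb0] at h
    push_cast at h
    linarith
  · rw [startB_succ, hb] at hA
    rw [startA_succ, startB_add_of_eq fun s hs ↦ hrun s hs.le, hlen] at hBk
    have h : k / (1 - x (D.a i)) <
        1 / (1 - x (D.a i)) + (1 / x (D.a i) - 1) / (1 - x (D.a i)) := by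
      linarith
    rwa [← add_div, div_lt_div_iff_of_pos_right hb0, add_sub_cancel] at h

variable [Finite Q]

theorem Completed.opened_succ (hC : D.Completed x w r i j)
    (hconn : (incompGraph Q).Preconnected) (hi : i + 1 < D.p)
    (hj : j + 1 < D.q) (h : D.inc i j) (h' : D.inc (i + 1) (j + 1)) :
    D.Opened x w r (i + 1) (j + 1) := by
  obtain ⟨hX, hY, hXY⟩ := count_succ_succ hconn hi hj h h'
  refine .completed (hC.le.trans hX) (hC.le.trans hY) ?_
  rcases hXY with hXY | hXY
  · exact hC.sq_mul_le'.trans hXY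
  · exact hC.sq_mul_le.trans hXY

theorem opened_succ_of_eq_sq (hR : D.prefixWeight x w (i + 1) (j + 1) = r ^ 2)
    (hconn : (incompGraph Q).Preconnected) (hi : i + 1 < D.p)
    (hj : j + 1 < D.q) (h : D.inc i j) (h' : D.inc (i + 1) (j + 1)) :
    D.Opened x w r (i + 1) (j + 1) := by
  obtain ⟨hX, hY, hXY⟩ := count_succ_succ hconn hi hj h h'
  have hX1 := D.one_le_count i (j + 1)
  have hY1 := D.one_le_count (i + 1) j
  refine .pair hR (by linarith) (by linarith) ?_
  rcases hXY with hXY | hXY <;> linarith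

theorem advances_of_startA_eq_startB (hT : D.IsTiling x) (hconn : (incompGraph Q).Preconnected)
    (hi : i < D.p) (hj : j < D.q) (h : D.inc i j)
    (heq : D.startA x (i + 1) = D.startB x (j + 1))
    (hs : D.Completed x w r i j ∨ i = 0 ∧ j = 0 ∧ D.prefixWeight x w 1 1 = r ^ 2) :
    D.Advances x w r i j := by
  have hend := hT.eq_p_iff_eq_q heq
  rcases eq_or_ne (i + 1) D.p with hip | hip
  · have hjq := hend.1 hip
    refine .inl ?_
    rcases hs with hC | ⟨rfl, rfl, -⟩
    · refine .inr ?_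
      rw [← hip, ← hjq]
      exact hC.le.trans (count_add_count_le h hi hj)
    · exact .inl ⟨hip.symm, hjq.symm⟩
  · have hi' : i + 1 < D.p := lt_of_le_of_ne hi hip
    have hj' : j + 1 < D.q := lt_of_le_of_ne hj (mt hend.2 hip)
    have h' := (hT.tight_of_overlap _ hi' _ hj'
      (heq.trans_lt (hT.startB_strictMono (Nat.lt_succ_self _)))
      (heq.symm.trans_lt (hT.startA_strictMono (Nat.lt_succ_self _)))).1
    refine .inr ⟨_, hi', _, hj', by omega, .opened heq ?_⟩
    rcases hs with hC | ⟨rfl, rfl, hR⟩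
    · exact hC.opened_succ hconn hi' hj' h h'
    · exact opened_succ_of_eq_sq hR hconn hi' hj' h h'

theorem Completed.advances (hC : D.Completed x w r i j) (hT : D.IsTiling x)
    (hconn : (incompGraph Q).Preconnected) (hi : i < D.p) (hj : j < D.q) (h : D.inc i j)
    (hB : D.startB x j < D.startA x (i + 1)) (hA : D.startA x (i + 1) ≤ D.startB x (j + 1))
    (hb : 2 / 3 ≤ x (D.b j)) {i₀ j₀ : ℕ} (hlt : i₀ + j₀ < i + j) : D.Advances x w r i₀ j₀ := by
  rcases hA.eq_or_lt with heq | hA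
  · exact (advances_of_startA_eq_startB hT hconn hi hj h heq (.inl hC)).of_le hlt.le
  · exact .inr ⟨i, hi, j, hj, hlt, .shared hB hA hb hC⟩

theorem Opened.completed_add (hO : D.Opened x w r i j) (hw : IsWeight w r) (hi : i < D.p)
    (hj : j + k < D.q) (h : ∀ s ≤ k, D.inc i (j + s)) (hk : 1 ≤ k) {starWeight : ℝ}
    (hR_eq : D.prefixWeight x w (i + 1) (j + k + 1) = D.prefixWeight x w i j * starWeight)
    (hstar : starWeight ≤ k + 2) (hstar' : r ^ 2 * starWeight ≤ 2 * k + 5)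
    (hstar'' : r ^ 4 * starWeight ≤ 4 * k + 12) :
    D.Completed x w r i (j + k) := by
  obtain ⟨hX, hY⟩ := count_run hi hj h
  have hk : (1 : ℝ) ≤ k := by exact_mod_cast hk
  have hR := D.prefixWeight_pos (x := x) (i := i) (j := j) hw
  have hRG1 := mul_le_mul_of_nonneg_left hstar hR.le
  have hRG2 := mul_le_mul_of_nonneg_left hstar' hR.le
  have of_le (c : ℝ) (hc : D.prefixWeight x w i j ≤ c) (hcX : c ≤ D.count i (j + 1))
      (hcY : c ≤ D.count (i + 1) j) : D.Completed x w r i (j + k) := by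
    have h1 := mul_le_mul_of_nonneg_left (hc.trans hcX) (zero_le_one.trans hk)
    have h2 := mul_le_mul_of_nonneg_right hk hR.le
    constructor <;> rw [hR_eq] <;> linarith
  rcases hO with ⟨rfl, rfl⟩ | ⟨heq, hX2, hY2, hXY⟩ | ⟨hRX, hRY, -⟩
  · exact of_le 1 (by simp [prefixWeight]) (D.one_le_count _ _) (D.one_le_count _ _)
  · have h1 := mul_le_mul_of_nonneg_left hX2 (zero_le_one.trans hk)
    constructor <;> rw [hR_eq, heq] <;> linarith
  · exact of_le _ le_rfl hRX hRY

theorem Opened.advances_of_le_third (hO : D.Opened x w r i j) (hT : D.IsTiling x)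
    (hconn : (incompGraph Q).Preconnected) (hw : IsWeight w r) (hi : i < D.p)
    (heq : D.startA x i = D.startB x j) (ha : x (D.a i) ≤ 1 / 3) : D.Advances x w r i j := by
  obtain ⟨k, hB, hA⟩ := hT.exists_startB_add_lt_and_le hi
    (heq.symm.trans_lt (hT.startA_strictMono (Nat.lt_succ_self i)))
  have hrun {s : ℕ} (hs : s ≤ k) := hT.tight_of_run hi
    (heq.trans_lt (hT.startB_strictMono (Nat.lt_succ_self j))) hB hs
  have hjk := hT.lt_q_of_startB_lt hi hB
  have ha0 := hT.pos (D.a i)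
  have hb0 : 0 < 1 - x (D.a i) := by linarith
  have hlen := one_div_eq_div_one_sub ha0 (by linarith)
  have hk1 : (k : ℝ) < 1 / x (D.a i) - 1 := by
    rw [startA_succ, heq, startB_add_of_eq fun s hs ↦ (hrun hs.le).2, add_lt_add_iff_left, hlen,
      div_lt_div_iff_of_pos_right hb0] at hB
    exact hB
  have hk2 : 1 / x (D.a i) - 1 ≤ (k + 1 : ℕ) := by
    rw [startA_succ, heq, add_assoc, startB_add_of_eq fun s hs ↦ (hrun (Nat.lt_succ_iff.1 hs)).2,
      add_le_add_iff_left, hlen, div_le_div_iff_of_pos_right hb0] at hA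
    exact hA
  have hthree : 3 ≤ 1 / x (D.a i) := (le_div_iff₀ ha0).2 (by linarith)
  push_cast at hk2
  have hk : 1 ≤ k := by
    have : (1 : ℝ) ≤ k := by linarith
    exact_mod_cast this
  obtain ⟨h1, h2, h4⟩ := hw.star (x (D.a i)) (k + 1) ha0 ha (by push_cast; linarith)
    (by push_cast; linarith)
  push_cast at h1 h2 h4
  have hC := hO.completed_add hw hi hjk (fun s hs ↦ (hrun hs).1) hk
    (starWeight := w (x (D.a i)) * w (1 - x (D.a i)) ^ (k + 1)) (by
      rw [add_assoc, prefixWeight_add_of_eq fun s hs ↦ (hrun (Nat.lt_succ_iff.1 hs)).2,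
        prefixWeight_succ_left, mul_assoc]) (by linarith) (by linarith) (by linarith)
  exact hC.advances hT hconn hi hjk (hrun le_rfl).1 hB hA (by linarith [(hrun le_rfl).2]) (by omega)

theorem Completed.completed_succ_add (hC : D.Completed x w r i j) (hw : IsWeight w r)
    (hi : i + 1 < D.p) (hj : j + k < D.q) (h : D.inc i j) (h' : ∀ s ≤ k, D.inc (i + 1) (j + s))
    (hk : 1 ≤ k) {starWeight : ℝ}
    (hR_eq : D.prefixWeight x w (i + 2) (j + k + 1) =
      D.prefixWeight x w (i + 1) (j + 1) * starWeight)
    (hstar : starWeight ≤ k + 1) (hstar' : r ^ 2 * starWeight ≤ 2 * k + 3) :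
    D.Completed x w r (i + 1) (j + k) := by
  obtain ⟨hX, hY⟩ := count_run hi hj h'
  have hk : (1 : ℝ) ≤ k := by exact_mod_cast hk
  have hR := D.prefixWeight_pos (x := x) (i := i + 1) (j := j + 1) hw
  have hRX := hC.le.trans (count_add_count_le h (by omega) (by omega))
  have h1 := mul_le_mul_of_nonneg_left hstar hR.le
  have h2 := mul_le_mul_of_nonneg_left hstar' hR.le
  have h3 := mul_le_mul_of_nonneg_left hRX (zero_le_one.trans hk)
  have h4 := mul_le_mul_of_nonneg_right hk hR.le
  have h5 := D.one_le_count (i + 2) j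
  constructor <;> rw [hR_eq] <;> linarith

theorem Completed.advances_of_shared (hC : D.Completed x w r i j) (hT : D.IsTiling x)
    (hconn : (incompGraph Q).Preconnected) (hw : IsWeight w r) (hi : i < D.p) (hj : j < D.q)
    (hB : D.startB x j < D.startA x (i + 1)) (hA : D.startA x (i + 1) < D.startB x (j + 1))
    (hb : 2 / 3 ≤ x (D.b j)) : D.Advances x w r i j := by
  have hi' := hT.lt_p_of_startA_lt hj hA
  have hmono := hT.startA_strictMono (Nat.lt_succ_self (i + 1))
  have h := (hT.tight_of_overlap i hi j hj
    ((hT.startA_strictMono (Nat.lt_succ_self i)).trans hA) hB).1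
  obtain ⟨k, hBk, hAk⟩ := hT.exists_startB_add_lt_and_le hi' (hB.trans hmono)
  have hrun {s : ℕ} (hs : s ≤ k) := hT.tight_of_run hi' hA hBk hs
  have hjk := hT.lt_q_of_startB_lt hi' hBk
  have hb1 : x (D.b j) = 1 - x (D.a (i + 1)) := (hrun k.zero_le).2
  have ha0 := hT.pos (D.a (i + 1))
  obtain ⟨hk2, hk1⟩ := hT.one_div_sub_two_lt_and_lt_one_div (fun _ hs ↦ (hrun hs).2) hB hA hBk hAk
  have hthree : 3 ≤ 1 / x (D.a (i + 1)) := (le_div_iff₀ ha0).2 (by linarith)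
  have hk : 1 ≤ k := by
    have : (1 : ℝ) < k := by linarith
    exact_mod_cast this.le
  obtain ⟨h1, h2, -⟩ := hw.star (x (D.a (i + 1))) k ha0 (by linarith) (by linarith) hk1
  have hC' := hC.completed_succ_add hw hi' hjk h (fun s hs ↦ (hrun hs).1) hk (by
    rw [add_right_comm, prefixWeight_add_of_eq (c := 1 - x (D.a (i + 1))) fun s hs ↦ by
      rw [add_right_comm]; exact (hrun (Nat.succ_le_of_lt hs)).2, prefixWeight_succ_left,
      mul_assoc]) h1 h2
  exact hC'.advances hT hconn hi' hjk (hrun le_rfl).1 hBk hAk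
    (by linarith [(hrun le_rfl).2]) (by omega)

theorem advances_of_zigzag (hT : D.IsTiling x) (hw : IsWeight w r) (hi : i < D.p)
    (h1 : D.startA x i < D.startB x (j + 1)) (h2 : D.startB x (j + 1) < D.startA x (i + 1))
    (h3 : D.startA x (i + 1) < D.startB x (j + 2)) (ha : 1 / 3 < x (D.a i))
    (ha' : x (D.a i) < 1 / 2)
    (hR : r ^ 2 * D.prefixWeight x w (i + 1) (j + 1) ≤
      3 * D.count i (j + 1) + 2 * D.count (i + 1) j) : D.Advances x w r i j := by
  have hj1 := hT.lt_q_of_startB_lt hi h2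
  have hi1 := hT.lt_p_of_startA_lt hj1 h3
  have hBj := hT.startB_strictMono (Nat.lt_succ_self j)
  obtain ⟨h00, -⟩ := hT.tight_of_overlap i hi j (by omega) h1 (hBj.trans h2)
  obtain ⟨h01, hsum⟩ := hT.tight_of_overlap i hi _ hj1
    (h1.trans (hT.startB_strictMono (Nat.lt_succ_self _))) h2
  obtain ⟨h11, hsum'⟩ := hT.tight_of_overlap _ hi1 _ hj1 h3
    (h2.trans (hT.startA_strictMono (Nat.lt_succ_self _)))
  have hX := count_le_count_succ_right h01 hi hj1
  have hY := count_add_count_le h00 hi (by omega)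
  have hX' := count_add_count_le h01 hi hj1
  have hY' := count_le_count_succ_left h11 hi1 hj1
  have hwR : D.prefixWeight x w (i + 2) (j + 2) =
      r ^ 2 * D.prefixWeight x w (i + 1) (j + 1) := by
    rw [prefixWeight_succ_left, prefixWeight_succ_right,
      hw.eq_of_lt_of_lt (x (D.a (i + 1))) (by linarith) (by linarith),
      hw.eq_of_lt_of_lt (x (D.b (j + 1))) (by linarith) (by linarith)]
    ring
  have hpos := D.one_le_count i (j + 1)
  exact .inr ⟨i + 1, hi1, j + 1, hj1, by omega,
    .alternating h2 h3 (by linarith) (by linarith) (by linarith) (by linarith)⟩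

theorem advances_of_alternating (hT : D.IsTiling x) (hconn : (incompGraph Q).Preconnected)
    (hw : IsWeight w r) (hi : i < D.p)
    (hB : D.startB x j < D.startA x i) (hA : D.startA x i < D.startB x (j + 1))
    (ha : 1 / 3 < x (D.a i)) (ha' : x (D.a i) < 1 / 2)
    (hR : D.prefixWeight x w (i + 1) (j + 1) ≤ 2 * D.count i (j + 1))
    (hR' : D.prefixWeight x w (i + 1) (j + 1) ≤ D.count i (j + 1) + D.count (i + 1) j) :
    D.Advances x w r i j := by
  have hAi := hT.startA_strictMono (Nat.lt_succ_self i)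
  have hBj {j : ℕ} := hT.startB_strictMono (Nat.lt_succ_self j)
  have hj := hT.lt_q_of_startB_lt hi.le hB
  obtain ⟨h00, hsum⟩ := hT.tight_of_overlap i hi j hj hA (hB.trans hAi)
  obtain ⟨hshort, hlong⟩ := one_div_one_sub_lt_and_lt_two_mul ha ha'
  have hB1 : D.startB x (j + 1) < D.startA x (i + 1) := by
    rw [startB_succ, startA_succ, eq_sub_of_add_eq' hsum]
    linarith
  have hj1 := hT.lt_q_of_startB_lt hi hB1
  obtain ⟨h01, hsum'⟩ := hT.tight_of_overlap i hi _ hj1 (hA.trans hBj) hB1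
  have hR0 := D.prefixWeight_pos (x := x) (i := i + 1) (j := j + 1) hw
  have hr1 := mul_le_mul_of_nonneg_right hw.const_le hR0.le
  have hr2 := mul_le_mul_of_nonneg_right hw.sq_le hR0.le
  have hr3 := mul_le_mul_of_nonneg_right hw.cube_le hR0.le
  have hX := count_le_count_succ_right h01 hi hj1
  have hY := count_add_count_le h00 hi hj
  have hpos := D.one_le_count (i + 1) j
  have hwR : D.prefixWeight x w (i + 1) (j + 2) =
      r * D.prefixWeight x w (i + 1) (j + 1) := by
    rw [prefixWeight_succ_right, mul_comm,
      hw.eq_of_lt_of_lt (x (D.b (j + 1))) (by linarith) (by linarith)]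
  rcases lt_trichotomy (D.startA x (i + 1)) (D.startB x (j + 2)) with h | h | h
  · exact advances_of_zigzag hT hw hi hA hB1 h ha ha' (by linarith)
  · refine (advances_of_startA_eq_startB hT hconn hi hj1 h01 h (.inl ?_)).of_le (by omega)
    constructor <;> rw [hwR] <;> linarith
  · have hB3 : D.startA x (i + 1) < D.startB x (j + 1 + 2) := by
      have hj2 := hT.lt_q_of_startB_lt hi h
      obtain ⟨-, hsum''⟩ := hT.tight_of_overlap i hi _ hj2 ((hA.trans hBj).trans hBj) h
      rw [startB_succ, startB_succ, startA_succ, eq_sub_of_add_eq' hsum',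
        eq_sub_of_add_eq' hsum'']
      linarith
    exact (advances_of_zigzag hT hw hi (hA.trans hBj) h hB3 ha ha'
      (by rw [hwR]; linarith)).of_le (by omega)

theorem Opened.sq_mul_le (hO : D.Opened x w r i j) (hw : IsWeight w r)
    (hR : D.prefixWeight x w (i + 1) (j + 1) = r ^ 2 * D.prefixWeight x w i j) :
    r ^ 2 * D.prefixWeight x w (i + 1) (j + 1) ≤ 3 * D.count i (j + 1) + 2 * D.count (i + 1) j ∧
      r ^ 2 * D.prefixWeight x w (i + 1) (j + 1) ≤
        2 * D.count i (j + 1) + 3 * D.count (i + 1) j := by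
  have hr4 := hw.pow_four_le
  have hX := D.one_le_count i (j + 1)
  have hY := D.one_le_count (i + 1) j
  rw [hR]
  rcases hO with ⟨rfl, rfl⟩ | ⟨heq, hX2, hY2, hXY⟩ | ⟨hRX, hRY, hXY⟩
  · have h1 : D.prefixWeight x w 0 0 = 1 := by simp [prefixWeight]
    rw [h1]
    constructor <;> linarith
  · rw [heq]
    have := hw.sq_le
    have : r ^ 2 * r ^ 4 ≤ 2237 / 1000 * 5 := by gcongr
    constructor <;> linarith
  · have hR0 := D.prefixWeight_pos (x := x) (i := i) (j := j) hw
    have := mul_le_mul_of_nonneg_right hr4 hR0.le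
    constructor <;> linarith

theorem Opened.advances_of_le_half (hO : D.Opened x w r i j) (hT : D.IsTiling x)
    (hconn : (incompGraph Q).Preconnected) (hw : IsWeight w r) (hi : i < D.p) (hj : j < D.q)
    (heq : D.startA x i = D.startB x j) (ha : 1 / 3 < x (D.a i)) (ha' : x (D.a i) ≤ 1 / 2) :
    D.Advances x w r i j := by
  have hBj {j : ℕ} := hT.startB_strictMono (Nat.lt_succ_self j)
  have hAi := hT.startA_strictMono (Nat.lt_succ_self i)
  obtain ⟨h, hsum⟩ := hT.tight_of_overlap i hi j hj (heq.trans_lt hBj) (heq.symm.trans_lt hAi)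
  have hR : D.prefixWeight x w (i + 1) (j + 1) = r ^ 2 * D.prefixWeight x w i j := by
    rw [prefixWeight_succ_left, prefixWeight_succ_right,
      hw.eq_of_lt_of_lt (x (D.a i)) (by linarith) (by linarith),
      hw.eq_of_lt_of_lt (x (D.b j)) (by linarith) (by linarith)]
    ring
  obtain ⟨hR2, hR2'⟩ := hO.sq_mul_le hw hR
  rcases ha'.eq_or_lt with ha' | ha'
  · refine advances_of_startA_eq_startB hT hconn hi hj h
      (by rw [startA_succ, startB_succ, heq, show x (D.b j) = x (D.a i) by linarith]) ?_
    rcases hO with ⟨rfl, rfl⟩ | ⟨heq, -, -, hXY⟩ | ⟨-, -, hXY⟩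
    · exact .inr ⟨rfl, rfl, by rw [hR]; simp [prefixWeight]⟩
    · exact .inl ⟨by rw [hR, heq]; linarith [hw.pow_four_le], hR2, hR2'⟩
    · exact .inl ⟨by rwa [hR], hR2, hR2'⟩
  · obtain ⟨hshort, hlong⟩ := one_div_one_sub_lt_and_lt_two_mul ha ha'
    have hB1 : D.startB x (j + 1) < D.startA x (i + 1) := by
      rw [startB_succ, startA_succ, eq_sub_of_add_eq' hsum]
      linarith
    obtain ⟨-, hsum'⟩ := hT.tight_of_overlap i hi _ (hT.lt_q_of_startB_lt hi hB1)
      ((heq.trans_lt hBj).trans hBj) hB1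
    refine advances_of_zigzag hT hw hi (heq.trans_lt hBj) hB1 ?_ ha ha' hR2
    rw [startB_succ, startB_succ, startA_succ, eq_sub_of_add_eq' hsum, eq_sub_of_add_eq' hsum']
    linarith

theorem Opened.advances (hO : D.Opened x w r i j) (hT : D.IsTiling x)
    (hconn : (incompGraph Q).Preconnected) (hw : IsWeight w r) (hi : i < D.p) (hj : j < D.q)
    (heq : D.startA x i = D.startB x j) (ha : x (D.a i) ≤ 1 / 2) : D.Advances x w r i j := by
  rcases le_or_gt (x (D.a i)) (1 / 3) with ha' | ha'
  · exact hO.advances_of_le_third hT hconn hw hi heq ha'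
  · exact hO.advances_of_le_half hT hconn hw hi hj heq ha' ha

theorem State.advances (hS : D.State x w r i j) (hT : D.IsTiling x)
    (hconn : (incompGraph Q).Preconnected) (hw : IsWeight w r) (hi : i < D.p) (hj : j < D.q) :
    D.Advances x w r i j ∨ D.swap.Advances x w r j i := by
  rcases hS with ⟨heq, hO⟩ | ⟨hB, hA, hb, hC⟩ | ⟨hB, hA, ha, ha', hR, hR'⟩
  · rcases le_total (x (D.a i)) (1 / 2) with ha | ha
    · exact .inl (hO.advances hT hconn hw hi hj heq ha)
    · have hsum := (hT.tight_of_overlap i hi j hj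
        (heq.trans_lt (hT.startB_strictMono (Nat.lt_succ_self j)))
        (heq.symm.trans_lt (hT.startA_strictMono (Nat.lt_succ_self i)))).2
      exact .inr (hO.swap.advances hT.swap hconn hw hj hi heq.symm
        (show x (D.b j) ≤ 1 / 2 by linarith))
  · exact .inl (hC.advances_of_shared hT hconn hw hi hj hB hA hb)
  · exact .inl (advances_of_alternating hT hconn hw hi hB hA ha ha' hR hR')

theorem State.weightBound {D : TwoChains Q} {i j : ℕ} (hS : D.State x w r i j)
    (hT : D.IsTiling x) (hconn : (incompGraph Q).Preconnected) (hw : IsWeight w r) (hi : i < D.p)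
    (hj : j < D.q) : D.WeightBound x w := by
  rcases hS.advances hT hconn hw hi hj with
    (h | ⟨i', hi', j', hj', hlt, hS'⟩) | (h | ⟨j', hj', i', hi', hlt, hS'⟩)
  · exact h
  · exact hS'.weightBound hT hconn hw hi' hj'
  · exact h.of_swap
  · exact (hS'.weightBound hT.swap hconn hw hj' hi').of_swap
termination_by D.p + D.q - (i + j)
decreasing_by all_goals simp only [swap_p, swap_q] at *; omega

theorem IsTiling.weightBound [Nonempty Q] (hT : D.IsTiling x)
    (hconn : (incompGraph Q).Preconnected) (hw : IsWeight w r) : D.WeightBound x w := by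
  have hstart : D.startA x 0 = D.startB x 0 := by simp [startA, startB]
  have hend := hT.eq_p_iff_eq_q hstart
  have hpq : 0 < D.p ∧ 0 < D.q := by
    rcases D.cover (Classical.arbitrary Q) with ⟨i, hi, -⟩ | ⟨j, hj, -⟩ <;> omega
  exact (State.opened hstart (.start rfl rfl)).weightBound hT hconn hw hpq.1 hpq.2

end TwoChains

end Comparison

section Rounding

variable {x y : ℝ}

/-- A monotone rounding of `(0, 1)` that is compatible with `x ↦ 1 - x`. Its values are `1 / q` and
`1 - 1 / q` for integers `q ≥ 3`, and `1 / 2`. -/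
def rounding (x : ℝ) : ℝ :=
  if x ≤ 1 / 3 then 1 / (⌊1 / x⌋₊ : ℝ) else
    if x < 2 / 3 then 1 / 2 else 1 - 1 / (⌊1 / (1 - x)⌋₊ : ℝ)

theorem three_le_floor_one_div (hx : 0 < x) (h : x ≤ 1 / 3) : 3 ≤ ⌊1 / x⌋₊ := by
  refine Nat.le_floor ((le_div_iff₀ hx).2 ?_)
  push_cast
  linarith

theorem rounding_of_le (h : x ≤ 1 / 3) : rounding x = 1 / (⌊1 / x⌋₊ : ℝ) :=
  if_pos h

theorem rounding_of_lt_of_lt (h : 1 / 3 < x) (h' : x < 2 / 3) : rounding x = 1 / 2 := by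
  rw [rounding, if_neg h.not_ge, if_pos h']

theorem rounding_of_ge (h : 2 / 3 ≤ x) : rounding x = 1 - 1 / (⌊1 / (1 - x)⌋₊ : ℝ) := by
  rw [rounding, if_neg (by linarith), if_neg h.not_gt]

theorem rounding_one_sub (x : ℝ) : rounding (1 - x) = 1 - rounding x := by
  rcases le_or_gt x (1 / 3) with h | h
  · rw [rounding_of_le h, rounding_of_ge (by linarith), sub_sub_cancel]
  · rcases lt_or_ge x (2 / 3) with h' | h'
    · rw [rounding_of_lt_of_lt h h', rounding_of_lt_of_lt (by linarith) (by linarith)]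
      norm_num
    · rw [rounding_of_ge h', rounding_of_le (x := 1 - x) (by linarith), sub_sub_cancel]

theorem rounding_le_rounding_of_le_third (hx : 0 < x) (hxy : x ≤ y) (h : y ≤ 1 / 3) :
    rounding x ≤ rounding y := by
  have hy := hx.trans_le hxy
  have hfloor : 0 < ⌊1 / y⌋₊ := (three_le_floor_one_div hy h).trans_lt' (by norm_num)
  rw [rounding_of_le (hxy.trans h), rounding_of_le h]
  gcongr

theorem rounding_pos_of_le_third (hx : 0 < x) (h : x ≤ 1 / 3) : 0 < rounding x := by
  have hfloor : 0 < ⌊1 / x⌋₊ := (three_le_floor_one_div hx h).trans_lt' (by norm_num)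
  rw [rounding_of_le h]
  positivity

theorem rounding_le_half (hx : 0 < x) (h : x < 2 / 3) : rounding x ≤ 1 / 2 := by
  rcases le_or_gt x (1 / 3) with h' | h'
  · have hfloor : (3 : ℝ) ≤ ⌊1 / x⌋₊ := by exact_mod_cast three_le_floor_one_div hx h'
    rw [rounding_of_le h']
    exact one_div_le_one_div_of_le (by norm_num) (by linarith)
  · exact (rounding_of_lt_of_lt h' h).le

theorem half_le_rounding (hx : x < 1) (h : 1 / 3 < x) : 1 / 2 ≤ rounding x := by
  have := rounding_le_half (x := 1 - x) (by linarith) (by linarith)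
  rw [rounding_one_sub] at this
  linarith

theorem rounding_pos (hx : 0 < x) (hx' : x < 1) : 0 < rounding x := by
  rcases le_or_gt x (1 / 3) with h | h
  · exact rounding_pos_of_le_third hx h
  · linarith [half_le_rounding hx' h]

theorem rounding_mono (hx : 0 < x) (hy : y < 1) (hxy : x ≤ y) : rounding x ≤ rounding y := by
  rcases le_or_gt y (1 / 3) with h | h
  · exact rounding_le_rounding_of_le_third hx hxy h
  · rcases lt_or_ge x (2 / 3) with h' | h'
    · exact (rounding_le_half hx h').trans (half_le_rounding hy h)
    · have := rounding_le_rounding_of_le_third (x := 1 - y) (y := 1 - x) (by linarith)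
        (by linarith) (by linarith)
      rw [rounding_one_sub, rounding_one_sub] at this
      linarith

theorem rounding_add_rounding_le_one (hx : 0 < x) (hy : 0 < y) (h : x + y ≤ 1) :
    rounding x + rounding y ≤ 1 := by
  have := rounding_mono (x := y) (y := 1 - x) hy (by linarith) (by linarith)
  rw [rounding_one_sub] at this
  linarith

end Rounding

section Constants

open Real

theorem div_le_logb_two {a n : ℕ} {b : ℝ} (hn : 0 < n) (h : 2 ^ a ≤ b ^ n) :
    (a / n : ℝ) ≤ logb 2 b := by
  rw [div_le_iff₀' (by exact_mod_cast hn), ← logb_pow, le_logb_iff_rpow_le one_lt_two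
    (h.trans_lt' (by positivity)), rpow_natCast]
  exact h

theorem logb_two_le_div {a n : ℕ} {b : ℝ} (hn : 0 < n) (hb : 0 < b) (h : b ^ n ≤ 2 ^ a) :
    logb 2 b ≤ (a / n : ℝ) := by
  rw [le_div_iff₀' (by exact_mod_cast hn), ← logb_pow, logb_le_iff_le_rpow one_lt_two
    (by positivity), rpow_natCast]
  exact h

theorem le_logb_two_three : 19 / 12 ≤ logb 2 3 := by
  exact_mod_cast div_le_logb_two (a := 19) (n := 12) (b := 3) (by norm_num) (by norm_num)

theorem logb_two_three_le : logb 2 3 ≤ 27 / 17 := by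
  exact_mod_cast logb_two_le_div (a := 27) (n := 17) (b := 3) (by norm_num) (by norm_num)
    (by norm_num)

theorem le_logb_two_five : 37 / 16 ≤ logb 2 5 := by
  exact_mod_cast div_le_logb_two (a := 37) (n := 16) (b := 5) (by norm_num) (by norm_num)

theorem le_logb_two_seven : 14 / 5 ≤ logb 2 7 := by
  exact_mod_cast div_le_logb_two (a := 14) (n := 5) (b := 7) (by norm_num) (by norm_num)

theorem two_sub_eps_mul_logb_two_three : (2 - eps) * logb 2 3 = 3 * logb 2 3 - 2 := by
  have : logb 2 3 ≠ 0 := by linarith [le_logb_two_three]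
  rw [eps, sub_sub_cancel, div_mul_cancel₀ _ this]

theorem eps_eq : eps = 2 / logb 2 3 - 1 := by
  have : logb 2 3 ≠ 0 := by linarith [le_logb_two_three]
  rw [eps]
  field_simp
  ring

theorem le_eps : 7 / 27 ≤ eps := by
  have h : (2 : ℝ) / (27 / 17) ≤ 2 / logb 2 3 :=
    div_le_div_of_nonneg_left zero_le_two (by linarith [le_logb_two_three]) logb_two_three_le
  rw [eps_eq]
  linarith

theorem eps_le : eps ≤ 5 / 19 := by
  have h : 2 / logb 2 3 ≤ (2 : ℝ) / (19 / 12) :=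
    div_le_div_of_nonneg_left zero_le_two (by norm_num) le_logb_two_three
  rw [eps_eq]
  linarith

theorem abs_eps_sub_lt : |eps - 0.26| < 0.005 := by
  have h1 := le_eps
  have h2 := eps_le
  rw [abs_lt]
  constructor <;> norm_num1 <;> linarith

end Constants

section StarCost

open Real

theorem log_add_one_sub_log_mul_le {m : ℝ} (hm : 1 < m) :
    (m + 1) * (log (m + 1) - log m) ≤ m * (log m - log (m - 1)) := by
  have h0 : 0 < m - 1 := sub_pos.2 hm
  have h1 : log (m + 1) - log m ≤ 1 / m := by
    rw [← log_div (by linarith) (by linarith)]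
    refine (log_le_sub_one_of_pos (by positivity)).trans_eq ?_
    field_simp
    ring
  have h2 : 1 / m ^ 2 ≤ 2 * log m - log (m - 1) - log (m + 1) := by
    have : 2 * log m = log (m ^ 2) := by rw [log_pow, Nat.cast_two]
    rw [sub_sub, ← log_mul (by positivity) (by positivity), this,
      ← log_div (by positivity) (by positivity)]
    refine le_trans (le_of_eq ?_) (one_sub_inv_le_log_of_pos (by positivity))
    field_simp
    ring
  have h3 : 1 / m ≤ m * (2 * log m - log (m - 1) - log (m + 1)) :=
    calc 1 / m = m * (1 / m ^ 2) := by field_simp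
      _ ≤ _ := mul_le_mul_of_nonneg_left h2 (by linarith)
  linarith

theorem logb_add_one_sub_logb_mul_le {b m : ℝ} (hb : 1 < b) (hm : 1 < m) :
    (m + 1) * (logb b (m + 1) - logb b m) ≤ m * (logb b m - logb b (m - 1)) := by
  have h := log_add_one_sub_log_mul_le hm
  have hlog := log_pos hb
  simp only [logb, ← sub_div, ← mul_div_assoc]
  gcongr

theorem logb_add_one_sub_logb_le {b c m s t : ℝ} (hb : 1 < b) (hc : 1 ≤ c) (hm : 0 < m)
    (ht : 0 < t) (hts : t < s) (h : t ≤ c * m * (s - t)) :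
    logb b (m + 1) - logb b m ≤ c * (logb b s - logb b t) := by
  have hs := ht.trans hts
  have hfrac : 0 ≤ (s - t) / t := div_nonneg (by linarith) ht.le
  have hbernoulli : 1 + c * ((s - t) / t) ≤ (s / t) ^ c := by
    have := one_add_mul_self_le_rpow_one_add (s := (s - t) / t) (by linarith) hc
    rwa [show 1 + (s - t) / t = s / t by field_simp; ring] at this
  rw [← logb_div (by linarith) (by linarith), ← logb_div (by linarith) (by linarith),
    ← logb_rpow_eq_mul_logb_of_pos (by positivity)]
  refine logb_le_logb_of_le hb (by positivity) (le_trans ?_ hbernoulli)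
  rw [add_div, div_self hm.ne']
  gcongr 1 + ?_
  rw [div_le_iff₀ hm, ← mul_div_assoc, div_mul_eq_mul_div, le_div_iff₀ ht]
  linarith

/-- The cost of a star with `m` leaves for the vector with entry `1 / (q + 1)` at the centre and
`q / (q + 1)` at the leaves. -/
def starCost (q m : ℕ) : ℝ :=
  logb 2 (q + 1) + m * (logb 2 (q + 1) - logb 2 q)

/-- The form that the condition `IsWeight.star` takes for `starCost q m`, with an incomparable pair
costing `2`. -/
def StarBound (q m : ℕ) : Prop :=
  starCost q m ≤ (2 - eps) * logb 2 (m + 1) ∧ starCost q m + 2 ≤ (2 - eps) * logb 2 (2 * m + 3) ∧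
    starCost q m + 4 ≤ (2 - eps) * logb 2 (4 * m + 8)

theorem logb_two_two_pow (n : ℕ) : logb 2 (2 ^ n) = n := by
  rw [logb_pow, logb_self_eq_one one_lt_two, mul_one]

theorem starBound_two_two : StarBound 2 2 := by
  have h3 := logb_two_three_le
  have h7 := le_logb_two_seven
  have heps := eps_le
  have hmul := two_sub_eps_mul_logb_two_three
  have h16 : logb 2 16 = 4 := by
    rw [show (16 : ℝ) = 2 ^ 4 by norm_num, logb_two_two_pow, Nat.cast_ofNat]
  have hcost : starCost 2 2 = 3 * logb 2 3 - 2 := by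
    norm_num [starCost]
    ring
  norm_num [StarBound, hcost, h16]
  refine ⟨by linarith, ?_, by linarith⟩
  nlinarith

theorem starBound_two_three : StarBound 2 3 := by
  have h3 := le_logb_two_three
  have h3' := logb_two_three_le
  have h5 := le_logb_two_five
  have heps := eps_le
  have hmul := two_sub_eps_mul_logb_two_three
  have h4 : logb 2 4 = 2 := by
    rw [show (4 : ℝ) = 2 ^ 2 by norm_num, logb_two_two_pow, Nat.cast_ofNat]
  have h9 : logb 2 9 = 2 * logb 2 3 := by
    rw [show (9 : ℝ) = 3 ^ 2 by norm_num, logb_pow, Nat.cast_ofNat]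
  have h20 : logb 2 20 = 2 + logb 2 5 := by
    rw [show (20 : ℝ) = 4 * 5 by norm_num, logb_mul (by norm_num) (by norm_num), h4]
  have hcost : starCost 2 3 = 4 * logb 2 3 - 3 := by
    norm_num [starCost]
    ring
  norm_num [StarBound, hcost, h4, h9, h20]
  refine ⟨by linarith, by linarith, ?_⟩
  nlinarith

variable {q : ℕ}

theorem starCost_succ_self_le (hq : 2 ≤ q) :
    starCost (q + 1) (q + 1) ≤ starCost q (q + 1) := by
  have hq : (2 : ℝ) ≤ q := by exact_mod_cast hq
  have h := logb_add_one_sub_logb_mul_le (m := q + 1) one_lt_two (by linarith)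
  rw [add_sub_cancel_right] at h
  simp only [starCost, Nat.cast_add, Nat.cast_one]
  linarith

theorem starCost_succ_add_two_le (hq : 2 ≤ q) :
    starCost (q + 1) (q + 2) ≤
      starCost q (q + 1) + (logb 2 (q + 1 + 1) - logb 2 (q + 1)) := by
  have hq : (2 : ℝ) ≤ q := by exact_mod_cast hq
  have h := logb_add_one_sub_logb_mul_le (m := q + 1) one_lt_two (by linarith)
  rw [add_sub_cancel_right] at h
  simp only [starCost, Nat.cast_add, Nat.cast_one, Nat.cast_ofNat]
  linarith

theorem starBound_add_one (hq : 2 ≤ q) : StarBound q (q + 1) := by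
  induction q, hq using Nat.le_induction with
  | base => exact starBound_two_three
  | succ q hq ih =>
    obtain ⟨h1, h2, h4⟩ := ih
    have hcost := starCost_succ_add_two_le hq
    have hq : (2 : ℝ) ≤ q := by exact_mod_cast hq
    have hc := eps_le
    have hstep (s t : ℝ) (ht : 0 < t) (hts : t < s) (h : t ≤ 33 / 19 * (q + 1) * (s - t)) :
        logb 2 (q + 1 + 1) - logb 2 (q + 1) ≤ (2 - eps) * (logb 2 s - logb 2 t) := by
      have : 33 / 19 ≤ 2 - eps := by linarith
      refine logb_add_one_sub_logb_le one_lt_two (by linarith) (by linarith) ht hts (h.trans ?_)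
      have : 0 ≤ s - t := by linarith
      gcongr
    have hstep1 := hstep (q + 1 + 1 + 1) (q + 1 + 1) (by linarith) (by linarith) (by linarith)
    have hstep2 := hstep (2 * (q + 1 + 1) + 3) (2 * (q + 1) + 3) (by linarith) (by linarith)
      (by linarith)
    have hstep4 := hstep (4 * (q + 1 + 1) + 8) (4 * (q + 1) + 8) (by linarith) (by linarith)
      (by linarith)
    push_cast [StarBound] at h1 h2 h4 ⊢
    refine ⟨?_, ?_, ?_⟩ <;> linarith

theorem starBound_self (hq : 2 ≤ q) : StarBound q q := by
  rcases hq.eq_or_lt with rfl | hq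
  · exact starBound_two_two
  · obtain ⟨q, rfl⟩ := Nat.exists_eq_add_of_le' (Nat.one_le_of_lt hq)
    have hcost := starCost_succ_self_le (Nat.lt_succ_iff.1 hq)
    obtain ⟨h1, h2, h4⟩ := starBound_add_one (Nat.lt_succ_iff.1 hq)
    exact ⟨by linarith, by linarith, by linarith⟩

end StarCost

section Weight

open Real

/-- The weight of an element with entry `x`. It is normalized so that the product of the weights is
`2 ^ (H / (2 - eps))`, where `H` is the cost of the rounded entries. -/
def weight (x : ℝ) : ℝ :=
  2 ^ (-logb 2 (rounding x) / (2 - eps))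

theorem rpow_div_le_iff {z y : ℝ} (hy : 0 < y) :
    (2 : ℝ) ^ (z / (2 - eps)) ≤ y ↔ z ≤ (2 - eps) * logb 2 y := by
  have hc := eps_le
  rw [← le_logb_iff_rpow_le one_lt_two hy, div_le_iff₀' (by linarith)]

theorem two_rpow_one_div_pow_mul (n : ℕ) (z : ℝ) :
    ((2 : ℝ) ^ (1 / (2 - eps))) ^ n * 2 ^ (z / (2 - eps)) = 2 ^ ((z + n) / (2 - eps)) := by
  rw [← rpow_natCast, ← rpow_mul zero_le_two, ← rpow_add two_pos]
  ring_nf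

theorem weight_mul_weight_one_sub_pow {x : ℝ} {q : ℕ} (hx : x ≤ 1 / 3) (hq : ⌊1 / x⌋₊ = q + 1)
    (hq0 : 0 < q) (m : ℕ) :
    weight x * weight (1 - x) ^ m = 2 ^ (starCost q m / (2 - eps)) := by
  have hq0 : (0 : ℝ) < q := by exact_mod_cast hq0
  have hround : rounding x = (q + 1 : ℝ)⁻¹ := by
    rw [rounding_of_le hx, hq, one_div, Nat.cast_succ]
  have hround' : rounding (1 - x) = q / (q + 1) := by
    rw [rounding_one_sub, hround]
    field_simp
    ring
  rw [weight, weight, hround, hround', ← rpow_natCast, ← rpow_mul zero_le_two,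
    ← rpow_add two_pos, logb_inv, logb_div hq0.ne' (by positivity), starCost]
  ring_nf

theorem isWeight_weight : IsWeight weight (2 ^ (1 / (2 - eps))) where
  pos x := rpow_pos_of_pos two_pos _
  eq_of_lt_of_lt x h h' := by
    rw [weight, rounding_of_lt_of_lt h h', one_div, logb_inv, logb_self_eq_one one_lt_two, neg_neg]
  const_pos := rpow_pos_of_pos two_pos _
  pow_four_le := by
    have h1 := eps_le
    have h5 := le_logb_two_five
    rw [← rpow_natCast, ← rpow_mul zero_le_two, div_mul_eq_mul_div, rpow_div_le_iff (by norm_num)]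
    push_cast
    nlinarith
  star x m hx hx' hm hm' := by
    have hfloor := three_le_floor_one_div hx hx'
    obtain ⟨q, hq⟩ : ∃ q, ⌊1 / x⌋₊ = q + 1 := Nat.exists_eq_add_of_le' (by omega)
    have hq1 : ((q + 1 : ℕ) : ℝ) ≤ 1 / x := hq ▸ Nat.floor_le (by positivity)
    have hq2 : 1 / x < ((q + 1 : ℕ) : ℝ) + 1 := hq ▸ Nat.lt_floor_add_one _
    have hm1 : q < m + 1 := by
      push_cast at hq1
      exact_mod_cast show (q : ℝ) < m + 1 by linarith
    have hm2 : m < q + 2 := by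
      push_cast at hq2
      exact_mod_cast show (m : ℝ) < q + 2 by linarith
    have hstar : StarBound q m := by
      obtain rfl | rfl : m = q ∨ m = q + 1 := by omega
      · exact starBound_self (by omega)
      · exact starBound_add_one (by omega)
    rw [weight_mul_weight_one_sub_pow hx' hq (by omega), two_rpow_one_div_pow_mul,
      two_rpow_one_div_pow_mul, rpow_div_le_iff (by positivity), rpow_div_le_iff (by positivity),
      rpow_div_le_iff (by positivity)]
    obtain ⟨h1, h2, h4⟩ := hstar
    exact ⟨h1, h2, h4⟩

end Weight

section Components

open Real

theorem rounding_mem_edgePolytope {V : Type*} {G : SimpleGraph V} {x : V → ℝ}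
    (hpos : ∀ v, 0 < x v) (hlt : ∀ v, x v < 1) (hx : ∀ u v, G.Adj u v → x u + x v ≤ 1) :
    (fun v ↦ rounding (x v)) ∈ edgePolytope G := by
  refine ⟨fun v ↦ ⟨(rounding_pos (hpos v) (hlt v)).le, ?_⟩,
    fun u v huv ↦ rounding_add_rounding_le_one (hpos u) (hpos v) (hx u v huv)⟩
  have := rounding_pos (x := 1 - x v) (sub_pos.2 (hlt v)) (sub_lt_self 1 (hpos v))
  rw [rounding_one_sub] at this
  linarith

theorem card_mul_graphEntropy_le_two_of_card_eq_two {V : Type*} [Fintype V] {G : SimpleGraph V}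
    (c : G.Coloring Bool) (h : Fintype.card V = 2) : Fintype.card V * graphEntropy G ≤ 2 := by
  have hhalf := edgePolytope_subset_stab c (const_mem_edgePolytope one_half_pos.le le_rfl)
  refine (card_mul_graphEntropy_le hhalf fun _ ↦ one_half_pos).trans_eq ?_
  rw [sum_const, card_univ, h, one_div, logb_inv, logb_self_eq_one one_lt_two]
  norm_num

theorem card_mul_graphEntropy_nonpos_of_subsingleton {V : Type*} [Fintype V] [Subsingleton V]
    {G : SimpleGraph V} : Fintype.card V * graphEntropy G ≤ 0 := by
  have hone : (1 : V → ℝ) ∈ stab G :=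
    subset_convexHull ℝ _ ⟨Set.univ, Set.Subsingleton.pairwise Set.subsingleton_univ _, by simp⟩
  simpa using card_mul_graphEntropy_le hone fun _ ↦ one_pos

variable {Q : Type*} [PartialOrder Q] {x : Q → ℝ}

theorem TwoChains.prefixWeight_weight [Fintype Q] (D : TwoChains Q) :
    D.prefixWeight x weight D.p D.q = 2 ^ ((∑ v, -logb 2 (rounding (x v))) / (2 - eps)) := by
  simp only [prefixWeight, weight, ← rpow_sum_of_pos two_pos, ← rpow_add two_pos, ← sum_div,
    ← add_div, D.sum_eq]

theorem TwoChains.IsTiling.two_le_count [Finite Q] {D : TwoChains Q} (hT : D.IsTiling x)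
    (hp : 0 < D.p) (hq : 0 < D.q) : 2 ≤ D.count 1 1 := by
  have hA : D.startA x 0 < D.startB x (0 + 1) := hT.startB_strictMono zero_lt_one
  have hB : D.startB x 0 < D.startA x (0 + 1) := hT.startA_strictMono zero_lt_one
  have hsplit := count_add_count_le (hT.tight_of_overlap 0 hp 0 hq hA hB).1 hp hq
  rw [zero_add] at hsplit
  linarith [D.one_le_count 0 1, D.one_le_count 1 0]

theorem card_mul_graphEntropy_le_of_isTiling [Fintype Q] [Nonempty Q]
    (c : (incompGraph Q).Coloring Bool)
    (hconn : (incompGraph Q).Preconnected) (hx : x ∈ edgePolytope (incompGraph Q))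
    (hx1 : ∀ v, x v < 1) {D : TwoChains Q} (hT : D.IsTiling x) :
    Fintype.card Q * graphEntropy (incompGraph Q) ≤
      (2 - eps) * logb 2 (numLinearExtensions Q) + if Fintype.card Q = 2 then eps else 0 := by
  have heps := le_eps
  have heps' := eps_le
  rcases hT.weightBound hconn isWeight_weight with ⟨hp, hq⟩ | hle
  · have hcard : Fintype.card Q = 2 := by
      have := D.sum_eq fun _ ↦ 1
      rw [hp, hq] at this
      norm_num at this
      exact_mod_cast this
    have htwo := hT.two_le_count (by omega) (by omega)
    have hcount := D.count_eq_numLinearExtensions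
    rw [hp, hq] at hcount
    have hlog : 1 ≤ logb 2 (numLinearExtensions Q) := by
      rw [← logb_self_eq_one one_lt_two, ← hcount]
      exact logb_le_logb_of_le one_lt_two two_pos htwo
    rw [if_pos hcard]
    nlinarith [card_mul_graphEntropy_le_two_of_card_eq_two c hcard]
  · have hround := rounding_mem_edgePolytope hT.pos hx1 hx.2
    have hcost := card_mul_graphEntropy_le (edgePolytope_subset_stab c hround)
      fun v ↦ rounding_pos (hT.pos v) (hx1 v)
    rw [D.prefixWeight_weight, D.count_eq_numLinearExtensions,
      rpow_div_le_iff (by exact_mod_cast numLinearExtensions_pos)] at hle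
    split_ifs <;> linarith

theorem card_mul_graphEntropy_le_of_preconnected [Fintype Q]
    (c : (incompGraph Q).Coloring Bool)
    (hconn : (incompGraph Q).Preconnected) :
    Fintype.card Q * graphEntropy (incompGraph Q) ≤
      (2 - eps) * logb 2 (numLinearExtensions Q) + if Fintype.card Q = 2 then eps else 0 := by
  rcases subsingleton_or_nontrivial Q
  · have hH := card_mul_graphEntropy_nonpos_of_subsingleton (G := incompGraph Q)
    have hlog : 0 ≤ logb 2 (numLinearExtensions Q : ℝ) :=
      logb_nonneg one_lt_two (by exact_mod_cast numLinearExtensions_pos)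
    have hlog' := mul_nonneg (show 0 ≤ 2 - eps by linarith [eps_le]) hlog
    split_ifs <;> linarith [le_eps]
  · obtain ⟨x, hx⟩ := exists_isOptimal c
    obtain ⟨D⟩ := nonempty_twoChains_of_coloring c
    have hx1 (v : Q) : x v < 1 := by
      obtain ⟨u, hvu⟩ := hconn.exists_adj_of_nontrivial v
      linarith [hx.mem.2 v u hvu, hx.pos u]
    exact card_mul_graphEntropy_le_of_isTiling c hconn hx.mem hx1 (hx.isTiling hx1 D)

variable {P : Type*} [PartialOrder P]

theorem sum_logb_numLinearExtensions_supp_le [Finite P]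
    [Fintype (incompGraph P).ConnectedComponent] :
    ∑ C : (incompGraph P).ConnectedComponent, logb 2 (numLinearExtensions C.supp) ≤
      logb 2 (numLinearExtensions P) := by
  have hpos (C : (incompGraph P).ConnectedComponent) : (0 : ℝ) < numLinearExtensions C.supp := by
    exact_mod_cast numLinearExtensions_pos
  rw [← logb_prod _ _ fun C _ ↦ (hpos C).ne']
  refine logb_le_logb_of_le one_lt_two (prod_pos fun C _ ↦ hpos C) ?_
  exact_mod_cast prod_numLinearExtensions_supp_le

theorem sum_ite_card_supp_eq_two [Fintype (incompGraph P).ConnectedComponent]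
    [∀ C : (incompGraph P).ConnectedComponent, Fintype C.supp] (a : ℝ) :
    ∑ C : (incompGraph P).ConnectedComponent, (if Fintype.card C.supp = 2 then a else 0) =
      a * kappaTwo P := by
  simp only [Set.fintypeCard_eq_ncard]
  rw [← sum_filter, sum_const, nsmul_eq_mul, mul_comm, kappaTwo, Nat.card_eq_fintype_card,
    Fintype.card_subtype]

theorem card_mul_graphEntropy_incompGraph_le [Fintype P] (c : (incompGraph P).Coloring Bool) :
    Fintype.card P * graphEntropy (incompGraph P) ≤
      (2 - eps) * logb 2 (numLinearExtensions P) + eps * kappaTwo P := by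
  classical
  have := Fintype.ofFinite (incompGraph P).ConnectedComponent
  calc Fintype.card P * graphEntropy (incompGraph P)
      ≤ ∑ C : (incompGraph P).ConnectedComponent,
          Fintype.card C.supp * graphEntropy (incompGraph C.supp) :=
        card_mul_graphEntropy_le_sum_components
    _ ≤ ∑ C : (incompGraph P).ConnectedComponent,
          ((2 - eps) * logb 2 (numLinearExtensions C.supp) +
            if Fintype.card C.supp = 2 then eps else 0) :=
        sum_le_sum fun C _ ↦ card_mul_graphEntropy_le_of_preconnected
          (c.comp C.toSimpleGraph_hom)
          C.connected_toSimpleGraph.preconnected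
    _ = (2 - eps) * ∑ C : (incompGraph P).ConnectedComponent, logb 2 (numLinearExtensions C.supp) +
          eps * kappaTwo P := by
        rw [sum_add_distrib, sum_ite_card_supp_eq_two, mul_sum]
    _ ≤ (2 - eps) * logb 2 (numLinearExtensions P) + eps * kappaTwo P := by
        have : 0 ≤ 2 - eps := by linarith [eps_le]
        gcongr
        exact sum_logb_numLinearExtensions_supp_le

end Components

end PosetEntropy

end

theorem theorem3 (P : Type*) [Fintype P] [PartialOrder P] (hP : PosetEntropy.HasWidth P 2) :
    (Fintype.card P : ℝ) * PosetEntropy.graphEntropy (PosetEntropy.incompGraph P) ≤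
        (2 - PosetEntropy.eps) * Real.logb 2 (PosetEntropy.numLinearExtensions P : ℝ) +
          PosetEntropy.eps * (PosetEntropy.kappaTwo P : ℝ) ∧
      |PosetEntropy.eps - 0.26| < 0.005 := by
  obtain ⟨c⟩ := hP.colorable
  exact ⟨PosetEntropy.card_mul_graphEntropy_incompGraph_le
    (SimpleGraph.recolorOfEquiv _ finTwoEquiv c), PosetEntropy.abs_eps_sub_lt⟩
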